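/- Let $n\ge 1$ and let $\mathbb B^n=\{z\in\mathbb C^n:\|z\|<1\}$ be the Euclidean unit ball. Let $S(\mathbb B^n)$ be the class of all injective holomorphic maps $f:\mathbb B^n\to\mathbb C^n$ with $f(0)=0$ and $df(0)=\mathrm{Id}$. A Loewner chain is a family $(f_t)_{t\ge0}$ of holomorphic maps $f_t:\mathbb B^n\to\mathbb C^n$ such that $e^{-t}f_t\in S(\mathbb B^n)$ for all $t\ge 0$ and $f_s(\mathbb B^n)\subseteq f_t(\mathbb B^n)$ whenever $0\le s\le t$; it is called normal if $\{e^{-t}f_t\}_{t\ge0}$ is a normal family, i.e. every sequence in this family has a subsequence converging locally uniformly on $\mathbb B^n$ to a map into $\mathbb C^n$. Let $S^0(\mathbb B^n)$ be the set of all $f\in S(\mathbb B^n)$ for which there is a normal Loewner chain $(f_t)_{t\ge0}$ with $f_0=f$. Let $f\in S^0(\mathbb B^n)$. Then for every $r\in(0,1)$ and every $z\in\mathbb C^n$ with $\|z\|\le r$, $$\|df(z)\|\le\frac{(1+\sqrt r)^2}{(1-r)^3},$$ where $\|\cdot\|$ on the left-hand side is the operator norm of linear maps $\mathbb C^n\to\mathbb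 C^n$ with respect to the Euclidean norm. -/

import Mathlib

open scoped NNReal

noncomputable section

/-- Complex Euclidean space `ℂⁿ`, with the norm induced by the standard Hermitian product. -/
abbrev Cn (n : ℕ) : Type := EuclideanSpace ℂ (Fin n)

/-- The open unit ball of `ℂⁿ`. -/
abbrev unitBall (n : ℕ) : Set (Cn n) := Metric.ball 0 1

/-- The class `S(𝔹ⁿ)` of normalized univalent maps. Maps on the ball are represented by functions
on `ℂⁿ`, of which only the values on the ball matter. -/
structure IsNormalizedUnivalent {n : ℕ} (f : Cn n → Cn n) : Prop where
  holomorphic : DifferentiableOn ℂ f (unitBall n)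
  univalent : Set.InjOn f (unitBall n)
  map_zero : f 0 = 0
  fderiv_zero : fderiv ℂ f 0 = ContinuousLinearMap.id ℂ (Cn n)

/-- A normal family of maps on `U` with values in `ℂⁿ`: every sequence in the family has a
subsequence that converges locally uniformly on `U` (to a map with values in `ℂⁿ`). -/
def IsNormalFamily {n : ℕ} (𝓕 : Set (Cn n → Cn n)) (U : Set (Cn n)) : Prop :=
  ∀ u : ℕ → Cn n → Cn n, (∀ k, u k ∈ 𝓕) →
    ∃ (φ : ℕ → ℕ) (g : Cn n → Cn n), StrictMono φ ∧
      TendstoLocallyUniformlyOn (fun k => u (φ k)) g Filter.atTop U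

/-- The rescaled map `e⁻ᵗ F_t`. -/
def rescaled {n : ℕ} (F : ℝ≥0 → Cn n → Cn n) (t : ℝ≥0) : Cn n → Cn n :=
  fun z => Real.exp (-(t : ℝ)) • F t z

/-- A Loewner chain `(F_t)_{t ≥ 0}` on the unit ball. -/
structure IsLoewnerChain {n : ℕ} (F : ℝ≥0 → Cn n → Cn n) : Prop where
  normalized : ∀ t, IsNormalizedUnivalent (rescaled F t)
  image_subset : ∀ s t, s ≤ t → F s '' unitBall n ⊆ F t '' unitBall n

/-- A normal Loewner chain. -/
structure IsNormalLoewnerChain {n : ℕ} (F : ℝ≥0 → Cn n → Cn n) : Prop extends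
    IsLoewnerChain F where
  normal : IsNormalFamily (Set.range (rescaled F)) (unitBall n)

/-- The class `S⁰(𝔹ⁿ)`: maps in `S(𝔹ⁿ)` that embed into a normal Loewner chain. -/
def classS0 (n : ℕ) : Set (Cn n → Cn n) :=
  {f | IsNormalizedUnivalent f ∧
    ∃ F : ℝ≥0 → Cn n → Cn n, IsNormalLoewnerChain F ∧ Set.EqOn (F 0) f (unitBall n)}

end

open scoped Topology
open Set Metric Filter

/-!
An injective holomorphic map between spaces of equal dimension has invertible differentials
(Osgood): otherwise the Jacobian determinant vanishes along a complex curve, where by induction on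
the dimension the whole differential vanishes, so the map is constant along the curve. Hence a
Loewner chain `F` has holomorphic transition maps `v = F_t⁻¹ ∘ F_s` of the ball, with `v 0 = 0` and
`dv(0) = e^{s-t} Id`. With `κ(x) = x / (1 - x)²`, Schwarz–Pick gives
`κ(‖v x‖) ≤ ((1 + e^{s-t}) / 2)² κ(‖x‖)`. The factor is `e^{s-t} + O((t - s)²)`, so subdividing
`[0, t]` yields `κ(‖y‖) ≤ e^{-t} κ(‖x‖)` for `F_t y = F_0 x`. By normality `e^{-t} F_t` is the
identity up to a quadratic error uniform in `t`, and letting `t → ∞` gives the growth bound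
`‖F_0 x‖ ≤ κ(‖x‖)`. A Cauchy estimate of Schwarz–Pick type on the ball of radius `√r` turns it
into the bound for the differential.
-/

section HolomorphicRegularity

theorem ball_half_subset_ball {X : Type*} [PseudoMetricSpace X] {x₀ x : X} {R : ℝ}
    (hx : x ∈ ball x₀ (R / 2)) : ball x (R / 2) ⊆ ball x₀ R :=
  ball_subset_ball' (by linarith [mem_ball.1 hx])

variable {E F : Type*} [NormedAddCommGroup E] [NormedSpace ℂ E]
  [NormedAddCommGroup F] [NormedSpace ℂ F]

theorem norm_fderiv_le_of_forall_mem_ball {f : E → F} {x : E} {ρ M : ℝ} (hρ : 0 < ρ)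
    (hd : DifferentiableOn ℂ f (ball x ρ)) (hM : ∀ y ∈ ball x ρ, ‖f y‖ ≤ M) :
    ‖fderiv ℂ f x‖ ≤ 2 * M / ρ := by
  refine Complex.norm_fderiv_le_div_of_mapsTo_ball hd (fun y hy ↦ ?_) hρ
  rw [mem_closedBall, dist_eq_norm]
  linarith [norm_sub_le (f y) (f x), hM y hy, hM x (mem_ball_self hρ)]

theorem norm_sub_linear_le_of_forall_mem_ball {f : E → F} {x y : E} {ρ M : ℝ} (hρ : 0 < ρ)
    (hd : DifferentiableOn ℂ f (ball x ρ)) (hM : ∀ y ∈ ball x ρ, ‖f y‖ ≤ M)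
    (hy : y ∈ ball x ρ) :
    ‖f y - f x - fderiv ℂ f x (y - x)‖ ≤ 4 * M * (‖y - x‖ / ρ) ^ 2 := by
  have hdx : DifferentiableAt ℂ f x := hd.differentiableAt (ball_mem_nhds _ hρ)
  have hlin : ∀ w ∈ ball x ρ, ‖fderiv ℂ f x (w - x)‖ ≤ 2 * M := fun w hw ↦ by
    have hbd := norm_fderiv_le_of_forall_mem_ball hρ hd hM
    calc ‖fderiv ℂ f x (w - x)‖ ≤ 2 * M / ρ * ρ :=
          ContinuousLinearMap.le_of_opNorm_le_of_le _ hbd (mem_ball_iff_norm.1 hw).le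
      _ = 2 * M := by field_simp
  have schwarz := Complex.dist_le_mul_div_pow_of_mapsTo_ball_of_isLittleO (n := 1) (c := x)
    (z := y) (R₁ := ρ) (R₂ := 4 * M) (f := fun y ↦ f y - fderiv ℂ f x (y - x))
    (hd.sub (by fun_prop)) (fun w hw ↦ ?_) ?_ hy
  · simp only [dist_eq_norm, sub_self, map_zero, sub_zero] at schwarz
    rwa [sub_right_comm] at schwarz
  · simp only [mem_closedBall, dist_eq_norm, sub_self, map_zero, sub_zero]
    linarith [norm_sub_le (f w - fderiv ℂ f x (w - x)) (f x),
      norm_sub_le (f w) (fderiv ℂ f x (w - x)), hM w hw, hM x (mem_ball_self hρ), hlin w hw]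
  · simp only [pow_one, sub_self, map_zero, sub_zero]
    exact (hdx.hasFDerivAt.isLittleO.congr_left fun w ↦ sub_right_comm _ _ _).norm_right

theorem uniformCauchySeqOn_fderiv {ι : Type*} {l : Filter ι} {q : ι → E → F} {s U : Set E} {ρ : ℝ}
    (hρ : 0 < ρ) (hs : ∀ x ∈ s, ball x ρ ⊆ U) (hq : ∀ᶠ i in l, DifferentiableOn ℂ (q i) U)
    (hcauchy : UniformCauchySeqOn q l U) :
    UniformCauchySeqOn (fun i ↦ fderiv ℂ (q i)) l s := by
  intro u hu
  obtain ⟨ε, hε, hεu⟩ := Metric.mem_uniformity_dist.1 hu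
  filter_upwards [hcauchy _ (Metric.dist_mem_uniformity (show 0 < ρ * ε / 4 by positivity)),
    hq.prod_mk hq] with ⟨i, j⟩ hij ⟨hi, hj⟩ x hx
  refine hεu ?_
  have hdiff : ∀ k, DifferentiableOn ℂ (q k) U → DifferentiableAt ℂ (q k) x := fun k hk ↦
    (hk.mono (hs x hx)).differentiableAt (ball_mem_nhds _ hρ)
  rw [dist_eq_norm, ← fderiv_sub (hdiff i hi) (hdiff j hj)]
  calc ‖fderiv ℂ (q i - q j) x‖ ≤ 2 * (ρ * ε / 4) / ρ :=
        norm_fderiv_le_of_forall_mem_ball hρ ((hi.sub hj).mono (hs x hx)) fun y hy ↦ by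
          simpa only [dist_eq_norm, Pi.sub_apply] using (hij y (hs x hx hy)).le
    _ = ε / 2 := by field_simp; norm_num
    _ < ε := half_lt_self hε

theorem differentiableOn_of_tendstoUniformlyOn [CompleteSpace F] {ι : Type*} {l : Filter ι}
    [l.NeBot] {q : ι → E → F} {g : E → F} {U : Set E} (hU : IsOpen U)
    (hq : ∀ᶠ i in l, DifferentiableOn ℂ (q i) U) (hqg : TendstoUniformlyOn q g l U) :
    DifferentiableOn ℂ g U := by
  intro x₀ hx₀
  obtain ⟨R, hR, hball⟩ := Metric.isOpen_iff.1 hU x₀ hx₀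
  have hcauchy : UniformCauchySeqOn (fun i ↦ fderiv ℂ (q i)) l (ball x₀ (R / 2)) :=
    uniformCauchySeqOn_fderiv (half_pos hR) (fun x hx ↦ (ball_half_subset_ball hx).trans hball) hq
      hqg.uniformCauchySeqOn
  have hlim : ∀ x ∈ ball x₀ (R / 2), ∃ L, Tendsto (fun i ↦ fderiv ℂ (q i) x) l (𝓝 L) :=
    fun x hx ↦ cauchy_map_iff_exists_tendsto.1 (hcauchy.cauchy_map hx)
  choose! g' hg' using hlim
  have hnhds : ball x₀ (R / 2) ∈ 𝓝 x₀ := ball_mem_nhds _ (half_pos hR)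
  refine (hasFDerivAt_of_tendstoUniformlyOnFilter (f := q)
    (((hcauchy.tendstoUniformlyOn_of_tendsto hg').tendstoUniformlyOnFilter).mono_right
      (le_principal_iff.2 hnhds)) ?_ ?_).differentiableAt.differentiableWithinAt
  · filter_upwards [hq.prod_mk (hU.eventually_mem hx₀)] with ⟨i, x⟩ ⟨hi, hx⟩
    exact (hi.differentiableAt (hU.mem_nhds hx)).hasFDerivAt
  · filter_upwards [hU.mem_nhds hx₀] with x hx using hqg.tendsto_at hx

theorem tendstoUniformlyOn_smul_sub_fderiv {f : E → F} {x₀ : E} {R M : ℝ} (hR : 0 < R)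
    (hd : DifferentiableOn ℂ f (ball x₀ R)) (hM : ∀ y ∈ ball x₀ R, ‖f y‖ ≤ M) (u : E) :
    TendstoUniformlyOn (fun (ε : ℂ) x ↦ ε⁻¹ • (f (x + ε • u) - f x))
      (fun x ↦ fderiv ℂ f x u) (𝓝[≠] 0) (ball x₀ (R / 2)) := by
  have hbound : Tendsto (fun ε : ℂ ↦ 4 * M * (‖u‖ / (R / 2)) ^ 2 * ‖ε‖) (𝓝[≠] 0) (𝓝 0) :=
    tendsto_nhdsWithin_of_tendsto_nhds (Continuous.tendsto' (by fun_prop) _ _ (by simp))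
  have hsmall : Tendsto (fun ε : ℂ ↦ ‖ε • u‖) (𝓝[≠] 0) (𝓝 0) :=
    tendsto_nhdsWithin_of_tendsto_nhds (Continuous.tendsto' (by fun_prop) _ _ (by simp))
  refine Metric.tendstoUniformlyOn_iff.2 fun η hη ↦ ?_
  filter_upwards [hbound.eventually_lt_const hη, hsmall.eventually_lt_const (half_pos hR),
    self_mem_nhdsWithin] with ε hεη hεR hε x hx
  have hε0 : ε ≠ 0 := hε
  have htaylor := norm_sub_linear_le_of_forall_mem_ball (y := x + ε • u) (half_pos hR)
    (hd.mono (ball_half_subset_ball hx)) (fun y hy ↦ hM y (ball_half_subset_ball hx hy))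
    (by simpa [mem_ball, dist_eq_norm] using hεR)
  rw [add_sub_cancel_left, map_smul] at htaylor
  refine lt_of_le_of_lt ?_ hεη
  calc dist (fderiv ℂ f x u) (ε⁻¹ • (f (x + ε • u) - f x))
      = ‖ε‖⁻¹ * ‖f (x + ε • u) - f x - ε • fderiv ℂ f x u‖ := by
        rw [dist_comm, dist_eq_norm, ← norm_inv, ← norm_smul, smul_sub _ _ (ε • _),
          inv_smul_smul₀ hε0]
    _ ≤ ‖ε‖⁻¹ * (4 * M * (‖ε • u‖ / (R / 2)) ^ 2) := by gcongr
    _ = 4 * M * (‖u‖ / (R / 2)) ^ 2 * ‖ε‖ := by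
        have := norm_ne_zero_iff.2 hε0
        rw [norm_smul]
        field_simp

theorem differentiableOn_fderiv_apply [CompleteSpace F] {f : E → F} {U : Set E}
    (hU : IsOpen U) (hf : DifferentiableOn ℂ f U) (u : E) :
    DifferentiableOn ℂ (fun x ↦ fderiv ℂ f x u) U := by
  intro x₀ hx₀
  have hcont : ContinuousAt f x₀ := (hf.differentiableAt (hU.mem_nhds hx₀)).continuousAt
  have hbdd : ∀ᶠ x in 𝓝 x₀, ‖f x‖ < ‖f x₀‖ + 1 :=
    hcont.norm.eventually_lt_const (lt_add_one _)
  obtain ⟨R, hR, hball⟩ := Metric.eventually_nhds_iff_ball.1 (hbdd.and (hU.eventually_mem hx₀))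
  have hfR : DifferentiableOn ℂ f (ball x₀ R) := hf.mono fun x hx ↦ (hball x hx).2
  have hquot : ∀ᶠ ε : ℂ in 𝓝[≠] 0,
      DifferentiableOn ℂ (fun x ↦ ε⁻¹ • (f (x + ε • u) - f x)) (ball x₀ (R / 2)) := by
    have hsmall : ∀ᶠ ε : ℂ in 𝓝 0, ‖ε • u‖ < R / 2 :=
      (Continuous.tendsto' (by fun_prop) (0 : ℂ) 0 (by simp)).eventually_lt_const (half_pos hR)
    filter_upwards [nhdsWithin_le_nhds hsmall] with ε hε
    refine (DifferentiableOn.sub (hfR.comp (by fun_prop) fun x hx ↦ ?_)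
      (hfR.mono (ball_subset_ball (by linarith)))).const_smul _
    exact ball_half_subset_ball hx (by simpa [mem_ball, dist_eq_norm] using hε)
  exact ((differentiableOn_of_tendstoUniformlyOn isOpen_ball hquot
    (tendstoUniformlyOn_smul_sub_fderiv hR hfR (fun x hx ↦ (hball x hx).1.le) u)).differentiableAt
      (ball_mem_nhds _ (half_pos hR))).differentiableWithinAt

theorem contDiffOn_nat_of_holomorphicOn [FiniteDimensional ℂ E] [CompleteSpace F] {f : E → F}
    {U : Set E} (hU : IsOpen U) (hf : DifferentiableOn ℂ f U) (n : ℕ) : ContDiffOn ℂ n f U := by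
  induction n generalizing f with
  | zero => exact contDiffOn_zero.2 hf.continuousOn
  | succ n ih =>
    rw [Nat.cast_succ, contDiffOn_succ_iff_fderiv_of_isOpen hU]
    exact ⟨hf, by simp, contDiffOn_clm_apply.2 fun u ↦ ih (differentiableOn_fderiv_apply hU hf u)⟩

theorem contDiffAt_one_of_holomorphicOn [FiniteDimensional ℂ E] [CompleteSpace F] {f : E → F}
    {U : Set E} (hU : IsOpen U) (hf : DifferentiableOn ℂ f U) {a : E} (ha : a ∈ U) :
    ContDiffAt ℂ 1 f a :=
  (contDiffOn_nat_of_holomorphicOn hU hf 1).contDiffAt (hU.mem_nhds ha)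

theorem exists_implicit_graph {K : Type*} [NormedAddCommGroup K] [NormedSpace ℂ K]
    [FiniteDimensional ℂ K] {G : K × ℂ → ℂ} {U : Set (K × ℂ)} (hU : IsOpen U)
    (hG : DifferentiableOn ℂ G U) {p : K × ℂ} (hp : p ∈ U) (hne : fderiv ℂ G p (0, 1) ≠ 0) :
    ∃ ψ : K → ℂ, (∀ᶠ k in 𝓝 p.1, DifferentiableAt ℂ ψ k) ∧
      ∀ᶠ q in 𝓝 p, G q = G p ↔ ψ q.1 = q.2 := by
  have hcd : ContDiffAt ℂ 1 G p := contDiffAt_one_of_holomorphicOn hU hG hp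
  have hinv : (fderiv ℂ G p ∘L .inr ℂ K ℂ).IsInvertible := by
    refine ⟨ContinuousLinearEquiv.unitsEquivAut ℂ (Units.mk0 _ hne), ?_⟩
    ext
    simp
  refine ⟨hcd.implicitFunction one_ne_zero hinv, ?_,
    hcd.eventually_apply_eq_iff_implicitFunction one_ne_zero hinv⟩
  exact ((hcd.contDiffAt_implicitFunction one_ne_zero hinv).eventually (by simp)).mono
    fun k hk ↦ hk.differentiableAt one_ne_zero

theorem not_eventually_fderiv_eq_zero [Nontrivial E] {f : E → F} {U : Set E} (hU : IsOpen U)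
    (hf : DifferentiableOn ℂ f U) (hinj : InjOn f U) {a : E} (ha : a ∈ U) :
    ¬ ∀ᶠ z in 𝓝 a, fderiv ℂ f z = 0 := by
  intro hzero
  obtain ⟨δ, hδ, hball⟩ := Metric.eventually_nhds_iff_ball.1 (hzero.and (hU.eventually_mem ha))
  have : (𝓝[≠] a).NeBot := Module.punctured_nhds_neBot ℂ E a
  obtain ⟨b, hb, hba⟩ : (ball a δ ∩ {a}ᶜ).Nonempty :=
    this.nonempty_of_mem (inter_mem (nhdsWithin_le_nhds (ball_mem_nhds a hδ)) self_mem_nhdsWithin)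
  have hconst : f b = f a :=
    isOpen_ball.is_const_of_fderiv_eq_zero (𝕜 := ℂ) (convex_ball a δ).isPreconnected
      (hf.mono fun y hy ↦ (hball y hy).2) (fun y hy ↦ (hball y hy).1) hb (mem_ball_self hδ)
  exact hba (hinj (hball b hb).2 ha hconst)

end HolomorphicRegularity

section OneVariable

theorem nhds_le_map_nhds_of_injOn {h : ℂ → ℂ} {U : Set ℂ} (hU : IsOpen U)
    (hd : DifferentiableOn ℂ h U) (hinj : InjOn h U) {x : ℂ} (hx : x ∈ U) :
    𝓝 (h x) ≤ map h (𝓝 x) := by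
  refine (hd.analyticAt (hU.mem_nhds hx)).eventually_constant_or_nhds_le_map_nhds.resolve_left
    fun hconst ↦ ?_
  have hself : ∀ᶠ z in 𝓝[≠] x, z = x := by
    filter_upwards [nhdsWithin_le_nhds hconst, nhdsWithin_le_nhds (hU.mem_nhds hx)] with z hz hzU
      using hinj hzU hx hz
  obtain ⟨z, hzx, hzne⟩ := (hself.and self_mem_nhdsWithin).exists
  exact hzne hzx

theorem differentiableAt_invFunOn {h : ℂ → ℂ} {U : Set ℂ} (hU : IsOpen U)
    (hd : DifferentiableOn ℂ h U) (hinj : InjOn h U) {a : ℂ} (ha : a ∈ U) :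
    DifferentiableAt ℂ (Function.invFunOn h U) (h a) := by
  set φ := Function.invFunOn h U
  have hleft : ∀ x ∈ U, φ (h x) = x := hinj.leftInvOn_invFunOn
  have hcont : ∀ x ∈ U, ContinuousAt φ (h x) := fun x hx ↦ by
    rw [ContinuousAt, hleft x hx]
    refine Tendsto.mono_left ?_ (nhds_le_map_nhds_of_injOn hU hd hinj hx)
    exact tendsto_map'_iff.2 <| tendsto_id.congr' <|
      (hU.eventually_mem hx).mono fun z hz ↦ (hleft z hz).symm
  have hright : ∀ x ∈ U, ∀ᶠ w in 𝓝 (h x), h (φ w) = w := fun x hx ↦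
    nhds_le_map_nhds_of_injOn hU hd hinj hx <| mem_map.2 <|
      (hU.eventually_mem hx).mono fun z hz ↦ congrArg h (hleft z hz)
  have hcrit : ∀ᶠ x in 𝓝[≠] a, deriv h x ≠ 0 :=
    (hd.deriv hU).analyticAt (hU.mem_nhds ha) |>.eventually_eq_zero_or_eventually_ne_zero
      |>.resolve_left fun hzero ↦ not_eventually_fderiv_eq_zero hU hd hinj ha <|
        hzero.mono fun z hz ↦ by ext; simp [hz]
  -- The critical values are isolated, hence removable singularities of the continuous inverse.
  refine (Complex.analyticAt_of_differentiable_on_punctured_nhds_of_continuousAt ?_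
    (hcont a ha)).differentiableAt
  rw [eventually_nhdsWithin_iff] at hcrit ⊢
  refine nhds_le_map_nhds_of_injOn hU hd hinj ha (mem_map.2 ?_)
  filter_upwards [hcrit, hU.eventually_mem ha] with x hx hxU hne
  have hxa : x ≠ a := fun hxa ↦ hne (by rw [hxa]; rfl)
  refine (HasDerivAt.of_local_left_inverse (hcont x hxU) ?_ (hx hxa)
    (hright x hxU)).differentiableAt
  rw [hleft x hxU]
  exact (hd.differentiableAt (hU.mem_nhds hxU)).hasDerivAt

theorem deriv_ne_zero_of_injOn {h : ℂ → ℂ} {U : Set ℂ} (hU : IsOpen U)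
    (hd : DifferentiableOn ℂ h U) (hinj : InjOn h U) {a : ℂ} (ha : a ∈ U) : deriv h a ≠ 0 := by
  intro hzero
  have hcomp : HasDerivAt (Function.invFunOn h U ∘ h)
      (deriv (Function.invFunOn h U) (h a) * deriv h a) a :=
    (differentiableAt_invFunOn hU hd hinj ha).hasDerivAt.comp a
      (hd.differentiableAt (hU.mem_nhds ha)).hasDerivAt
  have hid : Function.invFunOn h U ∘ h =ᶠ[𝓝 a] id :=
    (hU.eventually_mem ha).mono fun z hz ↦ hinj.leftInvOn_invFunOn hz
  have := hcomp.unique ((hasDerivAt_id a).congr_of_eventuallyEq hid)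
  simp [hzero] at this

theorem exists_mem_ball_eq_zero_of_norm_lt {h : ℂ → ℂ} {b : ℂ} {ε c : ℝ} (hε : 0 < ε)
    (hd : DifferentiableOn ℂ h (closedBall b ε)) (hc : ∀ y ∈ sphere b ε, c ≤ ‖h y‖)
    (hb : ‖h b‖ < c) : ∃ y ∈ ball b ε, h y = 0 := by
  by_contra! hne
  have hc0 : 0 < c := (norm_nonneg _).trans_lt hb
  have hne' : ∀ y ∈ closedBall b ε, h y ≠ 0 := fun y hy ↦
    (mem_closedBall.1 hy).lt_or_eq.elim (hne y)
      fun hy ↦ norm_pos_iff.1 (hc0.trans_le (hc y hy))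
  have hinv : ‖(h b)⁻¹‖ ≤ c⁻¹ :=
    Complex.norm_le_of_forall_mem_frontier_norm_le isBounded_ball
      ((hd.inv hne').diffContOnCl_ball subset_rfl) (fun y hy ↦ by
        rw [Pi.inv_apply, norm_inv]
        exact inv_anti₀ hc0 (hc y (frontier_ball_subset_sphere hy)))
      (subset_closure (mem_ball_self hε))
  rw [norm_inv, inv_le_inv₀ (norm_pos_iff.2 (hne b (mem_ball_self hε))) hc0] at hinv
  exact hinv.not_gt hb

theorem hurwitz_eventually_exists_zero_snd {X : Type*} [TopologicalSpace X] {g : X × ℂ → ℂ}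
    {p : X × ℂ} {P : X × ℂ → Prop} (hP : ∀ᶠ q in 𝓝 p, P q) (hcont : ∀ᶠ q in 𝓝 p, ContinuousAt g q)
    (hdiff : ∀ᶠ q in 𝓝 p, DifferentiableAt ℂ (fun y ↦ g (q.1, y)) q.2) (hp : g p = 0)
    (hiso : ∀ᶠ y in 𝓝[≠] p.2, g (p.1, y) ≠ 0) :
    ∀ᶠ x in 𝓝 p.1, ∃ y, P (x, y) ∧ g (x, y) = 0 := by
  obtain ⟨V, hV, W, hW, hVW⟩ := Filter.eventually_prod_iff.1
    (nhds_prod_eq (x := p.1) (y := p.2) ▸ (hP.and (hcont.and hdiff)))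
  obtain ⟨ε, hε, hεball⟩ := Metric.nhds_basis_closedBall.mem_iff.1
    (hW.and (eventually_nhdsWithin_iff.1 hiso))
  have hgood : ∀ x, V x → ∀ y ∈ closedBall p.2 ε, P (x, y) ∧ ContinuousAt g (x, y) ∧
      DifferentiableAt ℂ (fun y ↦ g (x, y)) y := fun x hx y hy ↦ hVW hx (hεball hy).1
  have hcircle : IsCompact (sphere p.2 ε) := isCompact_sphere _ _
  have hslice : ∀ x, V x → DifferentiableOn ℂ (fun y ↦ g (x, y)) (closedBall p.2 ε) :=
    fun x hx y hy ↦ (hgood x hx y hy).2.2.differentiableWithinAt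
  have hVp : V p.1 := hV.self_of_nhds
  obtain ⟨m, hm, hmle⟩ := hcircle.exists_forall_le' (a := 0)
    ((hslice _ hVp).continuousOn.norm.mono sphere_subset_closedBall) fun y hy ↦
      norm_pos_iff.2 ((hεball (sphere_subset_closedBall hy)).2 (ne_of_mem_sphere hy hε.ne'))
  obtain ⟨c, hc0, hcm⟩ := exists_between hm
  have hsphere : ∀ᶠ x in 𝓝 p.1, ∀ y ∈ sphere p.2 ε, c < ‖g (x, y)‖ :=
    hcircle.eventually_forall_of_forall_eventually fun y hy ↦
      (hgood _ hVp y (sphere_subset_closedBall hy)).2.1.norm.eventually_const_lt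
        (hcm.trans_le (hmle y hy))
  have hcenter : ∀ᶠ x in 𝓝 p.1, ‖g (x, p.2)‖ < c := by
    have : ContinuousAt (fun x ↦ g (x, p.2)) p.1 :=
      ContinuousAt.comp (f := fun x ↦ (x, p.2)) hcont.self_of_nhds (by fun_prop)
    exact this.norm.eventually_lt_const (by simpa [hp] using hc0)
  filter_upwards [hV, hsphere, hcenter] with x hxV hxs hxc
  obtain ⟨y, hy, hgy⟩ := exists_mem_ball_eq_zero_of_norm_lt hε (hslice x hxV)
    (fun y hy ↦ (hxs y hy).le) hxc
  exact ⟨y, (hgood x hxV y (ball_subset_closedBall hy)).1, hgy⟩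

end OneVariable

section ZeroSets

/-- The `k`-fold partial derivative of `g` in the second variable. Following one of these along the
zeros of `g` replaces `g` by a function with a simple zero. -/
noncomputable def partialSnd (g : ℂ × ℂ → ℂ) : ℕ → ℂ × ℂ → ℂ
  | 0 => g
  | k + 1 => fun q ↦ fderiv ℂ (partialSnd g k) q (0, 1)

variable {g : ℂ × ℂ → ℂ} {U : Set (ℂ × ℂ)} {p : ℂ × ℂ}

theorem differentiableOn_partialSnd (hU : IsOpen U) (hg : DifferentiableOn ℂ g U) (k : ℕ) :
    DifferentiableOn ℂ (partialSnd g k) U := by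
  induction k with
  | zero => exact hg
  | succ k ih => exact differentiableOn_fderiv_apply hU ih _

theorem partialSnd_eventuallyEq_iteratedDeriv (hU : IsOpen U) (hg : DifferentiableOn ℂ g U)
    (hp : p ∈ U) (k : ℕ) :
    (fun y ↦ partialSnd g k (p.1, y)) =ᶠ[𝓝 p.2] iteratedDeriv k (fun y ↦ g (p.1, y)) := by
  induction k with
  | zero => simp [partialSnd, iteratedDeriv_zero]
  | succ k ih =>
    have hcont : ContinuousAt (fun y : ℂ ↦ (p.1, y)) p.2 := by fun_prop
    filter_upwards [ih.eventually_nhds, hcont.eventually (hU.eventually_mem hp)] with y hy hyU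
    have hfderiv : HasFDerivAt (partialSnd g k) (fderiv ℂ (partialSnd g k) (p.1, y)) (p.1, y) :=
      ((differentiableOn_partialSnd hU hg k).differentiableAt (hU.mem_nhds hyU)).hasFDerivAt
    have hline : HasDerivAt (fun y : ℂ ↦ (p.1, y)) ((0 : ℂ), (1 : ℂ)) y :=
      (hasDerivAt_const _ _).prodMk (hasDerivAt_id _)
    rw [iteratedDeriv_succ, ← Filter.EventuallyEq.deriv_eq hy]
    exact (hfderiv.comp_hasDerivAt y hline).deriv.symm

theorem analyticAt_snd_slice (hU : IsOpen U) (hg : DifferentiableOn ℂ g U) (hp : p ∈ U) :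
    AnalyticAt ℂ (fun y ↦ g (p.1, y)) p.2 :=
  (hg.comp (t := U) (s := (fun y ↦ (p.1, y)) ⁻¹' U) (by fun_prop) fun _ hy ↦ hy).analyticAt
    ((hU.preimage (by fun_prop)).mem_nhds hp)

theorem eventually_eq_zero_snd_slice_iff (hU : IsOpen U) (hg : DifferentiableOn ℂ g U)
    (hp : p ∈ U) : (∀ᶠ y in 𝓝 p.2, g (p.1, y) = 0) ↔ ∀ k, partialSnd g k p = 0 := by
  have hval : ∀ k, partialSnd g k p = iteratedDeriv k (fun y ↦ g (p.1, y)) p.2 := fun k ↦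
    (partialSnd_eventuallyEq_iteratedDeriv hU hg hp k).self_of_nhds
  rw [← analyticOrderAt_eq_top, ENat.eq_top_iff_forall_ge]
  simp_rw [natCast_le_analyticOrderAt_iff_iteratedDeriv_eq_zero (analyticAt_snd_slice hU hg hp),
    hval]
  exact ⟨fun h k ↦ h (k + 1) k k.lt_succ_self, fun h k i _ ↦ h i⟩

theorem exists_minimal_vanishing_order (hU : IsOpen U) (hg : DifferentiableOn ℂ g U)
    (hp : p ∈ U) (hp0 : g p = 0) (hnz : ¬ ∀ᶠ y in 𝓝 p.2, g (p.1, y) = 0) :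
    ∃ m, (∀ q ∈ U, g q = 0 → partialSnd g m q = 0) ∧
      ∃ q ∈ U, g q = 0 ∧ partialSnd g (m + 1) q ≠ 0 := by
  classical
  have hex : ∃ k, ∃ q ∈ U, g q = 0 ∧ partialSnd g k q ≠ 0 := by
    rw [eventually_eq_zero_snd_slice_iff hU hg hp] at hnz
    push Not at hnz
    exact hnz.imp fun k hk ↦ ⟨p, hp, hp0, hk⟩
  obtain ⟨q, hq, hq0, hqk⟩ := Nat.find_spec hex
  obtain ⟨m, hm⟩ : ∃ m, Nat.find hex = m + 1 :=
    Nat.exists_eq_succ_of_ne_zero fun hzero ↦ by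
      rw [hzero] at hqk
      exact hqk hq0
  refine ⟨m, fun q' hq' hq'0 ↦ ?_, q, hq, hq0, hm ▸ hqk⟩
  by_contra hne
  exact Nat.find_min hex (hm ▸ m.lt_succ_self) ⟨q', hq', hq'0, hne⟩

theorem exists_graph_subset_zeros (hU : IsOpen U) (hg : DifferentiableOn ℂ g U)
    (hp : p ∈ U) (hp0 : g p = 0) (hnz : ¬ ∀ᶠ y in 𝓝 p.2, g (p.1, y) = 0) :
    ∃ (x₀ : ℂ) (γ : ℂ → ℂ), ∀ᶠ x in 𝓝 x₀,
      DifferentiableAt ℂ γ x ∧ (x, γ x) ∈ U ∧ g (x, γ x) = 0 := by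
  obtain ⟨m, hm, q, hq, hq0, hqm⟩ := exists_minimal_vanishing_order hU hg hp hp0 hnz
  obtain ⟨ψ, hψ, hgraph⟩ := exists_implicit_graph hU (differentiableOn_partialSnd hU hg m) hq hqm
  rw [hm q hq hq0] at hgraph
  have hiso : ∀ᶠ y in 𝓝[≠] q.2, g (q.1, y) ≠ 0 :=
    (analyticAt_snd_slice hU hg hq).eventually_eq_zero_or_eventually_ne_zero.resolve_left
      fun hzero ↦ hqm ((eventually_eq_zero_snd_slice_iff hU hg hq).1 hzero _)
  -- The zeros of `g` near `q` lie on `partialSnd g m = 0`, which is the graph of `ψ`.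
  have hzeros := hurwitz_eventually_exists_zero_snd ((hU.eventually_mem hq).and hgraph)
    ((hU.eventually_mem hq).mono fun v hv ↦ hg.continuousOn.continuousAt (hU.mem_nhds hv))
    ((hU.eventually_mem hq).mono fun v hv ↦ (analyticAt_snd_slice hU hg hv).differentiableAt)
    hq0 hiso
  refine ⟨q.1, ψ, ?_⟩
  filter_upwards [hzeros, hψ] with x ⟨y, ⟨hyU, hyψ⟩, hgy⟩ hψx
  obtain rfl : ψ x = y := hyψ.1 (hm _ hyU hgy)
  exact ⟨hψx, hyU, hgy⟩

variable {E : Type*} [NormedAddCommGroup E] [NormedSpace ℂ E]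

theorem exists_direction_not_eventually_zero {J : E → ℂ} {U : Set E} (hU : IsOpen U)
    (hJ : DifferentiableOn ℂ J U) {a : E} (ha : a ∈ U) (hnz : ¬ ∀ᶠ z in 𝓝 a, J z = 0) :
    ∃ v, ¬ ∀ᶠ y : ℂ in 𝓝 0, J (a + y • v) = 0 := by
  obtain ⟨R, hR, hball⟩ := Metric.isOpen_iff.1 hU a ha
  by_contra! hall
  refine hnz (Metric.eventually_nhds_iff_ball.2 ⟨R, hR, fun z hz ↦ ?_⟩)
  set V : Set ℂ := LinearMap.toSpanSingleton ℂ E (z - a) ⁻¹' ball 0 R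
  have hV : IsOpen V := isOpen_ball.preimage (LinearMap.continuous_of_finiteDimensional _)
  have hVconn : IsPreconnected V := ((convex_ball 0 R).linear_preimage
    ((LinearMap.toSpanSingleton ℂ E (z - a)).restrictScalars ℝ)).isPreconnected
  have han : AnalyticOnNhd ℂ (fun y : ℂ ↦ J (a + y • (z - a))) V :=
    ((hJ.mono hball).comp (by fun_prop) fun y hy ↦ by
      simpa [V, mem_ball, dist_eq_norm] using hy).analyticOnNhd hV
  have hzero := han.eqOn_zero_of_preconnected_of_eventuallyEq_zero hVconn (z₀ := 0)
    (by simpa [V] using hR) (hall (z - a)) (x := 1)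
    (by simpa [V, mem_ball, dist_eq_norm] using hz)
  simpa using hzero

theorem exists_curve_subset_zeros (hE : 2 ≤ Module.finrank ℂ E) {J : E → ℂ} {U : Set E}
    (hU : IsOpen U) (hJ : DifferentiableOn ℂ J U) {a : E} (ha : a ∈ U) (hJa : J a = 0)
    (hnz : ¬ ∀ᶠ z in 𝓝 a, J z = 0) :
    ∃ (c : ℂ → E) (D : Set ℂ), IsOpen D ∧ D.Nonempty ∧ DifferentiableOn ℂ c D ∧ InjOn c D ∧
      MapsTo c D (U ∩ {z | J z = 0}) := by
  obtain ⟨v, hv⟩ := exists_direction_not_eventually_zero hU hJ ha hnz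
  have hv0 : v ≠ 0 := by
    rintro rfl
    exact hv (by simp [hJa])
  obtain ⟨u, hu⟩ := exists_linearIndependent_pair_of_one_lt_finrank (R := ℂ) hE hv0
  set plane : ℂ × ℂ → E := fun p ↦ a + (p.1 • u + p.2 • v)
  have hplane : Differentiable ℂ plane := by fun_prop
  obtain ⟨x₀, γ, hγ⟩ := exists_graph_subset_zeros (p := (0, 0)) (hU.preimage hplane.continuous)
    (hJ.comp hplane.differentiableOn fun p hp ↦ hp) (by simpa [plane] using ha)
    (by simpa [plane] using hJa) (by simpa [plane] using hv)
  obtain ⟨D, hD, hDo, hx₀⟩ := _root_.eventually_nhds_iff.1 hγ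
  refine ⟨fun x ↦ plane (x, γ x), D, hDo, ⟨x₀, hx₀⟩, fun x hx ↦ ?_, fun x _ y _ hxy ↦ ?_,
    fun x hx ↦ (hD x hx).2⟩
  · exact (hplane.differentiableAt.comp x (f := fun x ↦ (x, γ x))
      (differentiableAt_id.prodMk (hD x hx).1)).differentiableWithinAt
  · have hcomb : (γ x - γ y) • v + (x - y) • u = 0 := by
      rw [← sub_eq_zero.2 (add_left_cancel hxy)]
      module
    exact sub_eq_zero.1 (LinearIndependent.pair_iff.1 hu _ _ hcomb).2

end ZeroSets

section Osgood

/-- The assertion of Osgood's theorem for maps from `E` to `F`: injective holomorphic maps on open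
sets have injective differentials. It is stated for a pair of spaces because the induction on the
dimension passes to hyperplanes. -/
def InjectiveDifferentials (E F : Type*) [NormedAddCommGroup E] [NormedSpace ℂ E]
    [NormedAddCommGroup F] [NormedSpace ℂ F] : Prop :=
  ∀ ⦃f : E → F⦄ ⦃U : Set E⦄, IsOpen U → DifferentiableOn ℂ f U → InjOn f U →
    ∀ a ∈ U, Function.Injective (fderiv ℂ f a)

variable {E E' F F' : Type*} [NormedAddCommGroup E] [NormedSpace ℂ E]
  [NormedAddCommGroup E'] [NormedSpace ℂ E'] [NormedAddCommGroup F] [NormedSpace ℂ F]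
  [NormedAddCommGroup F'] [NormedSpace ℂ F']

theorem fderiv_equiv_comp_comp_equiv (e : E ≃L[ℂ] E') (e' : F ≃L[ℂ] F') (f : E → F) (a : E) :
    fderiv ℂ (e' ∘ f ∘ e.symm) (e a) = e' ∘L fderiv ℂ f a ∘L e.symm := by
  rw [e'.comp_fderiv, e.symm.comp_right_fderiv, e.symm_apply_apply]

theorem differentiableOn_equiv_comp_comp_equiv (e : E ≃L[ℂ] E') (e' : F ≃L[ℂ] F') {f : E → F}
    {U : Set E} (hf : DifferentiableOn ℂ f U) :
    DifferentiableOn ℂ (e' ∘ f ∘ e.symm) (e.symm ⁻¹' U) :=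
  e'.differentiable.comp_differentiableOn (hf.comp e.symm.differentiable.differentiableOn
    fun _ hx ↦ hx)

theorem injOn_equiv_comp_comp_equiv (e : E ≃L[ℂ] E') (e' : F ≃L[ℂ] F') {f : E → F} {U : Set E}
    (hf : InjOn f U) : InjOn (e' ∘ f ∘ e.symm) (e.symm ⁻¹' U) :=
  fun _ hx _ hy hxy ↦ e.symm.injective (hf hx hy (e'.injective hxy))

theorem injective_fderiv_of_equiv_comp_comp_equiv (e : E ≃L[ℂ] E') (e' : F ≃L[ℂ] F') {f : E → F}
    {a : E} (h : Function.Injective (fderiv ℂ (e' ∘ f ∘ e.symm) (e a))) :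
    Function.Injective (fderiv ℂ f a) := by
  rw [fderiv_equiv_comp_comp_equiv] at h
  refine Function.Injective.of_comp (f := e') ?_
  simpa [Function.comp_def] using h.comp e.injective

theorem InjectiveDifferentials.congr (h : InjectiveDifferentials E' F') (e : E ≃L[ℂ] E')
    (e' : F ≃L[ℂ] F') : InjectiveDifferentials E F := by
  intro f U hU hf hinj a ha
  exact injective_fderiv_of_equiv_comp_comp_equiv e e' (h (hU.preimage e.symm.continuous)
    (differentiableOn_equiv_comp_comp_equiv e e' hf) (injOn_equiv_comp_comp_equiv e e' hinj) (e a)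
    (by simpa))

theorem injectiveDifferentials_complex : InjectiveDifferentials ℂ ℂ := by
  intro f U hU hf hinj a ha
  refine (injective_iff_map_eq_zero _).2 fun w hw ↦ ?_
  rw [fderiv_eq_smul_deriv, smul_eq_mul] at hw
  exact (mul_eq_zero.1 hw).resolve_right (deriv_ne_zero_of_injOn hU hf hinj ha)

theorem injective_of_injective_fst_comp_graph {K K' : Type*} [NormedAddCommGroup K]
    [NormedSpace ℂ K] [NormedAddCommGroup K'] [NormedSpace ℂ K'] {L : K × ℂ →L[ℂ] K' × ℂ}
    {T : K →L[ℂ] ℂ} (hne : (L (0, 1)).2 ≠ 0) (hsnd : ∀ k, (L (k, T k)).2 = 0)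
    (hfst : Function.Injective fun k ↦ (L (k, T k)).1) : Function.Injective L := by
  refine (injective_iff_map_eq_zero _).2 fun ⟨k, t⟩ hkt ↦ ?_
  have hsplit : L (k, t) = L (k, T k) + (t - T k) • L (0, 1) := by
    rw [← map_smul, ← map_add]
    simp
  have ht : t = T k := by
    have := congrArg Prod.snd hsplit
    rw [hkt, Prod.snd_add, hsnd, zero_add, Prod.smul_snd, Prod.snd_zero, smul_eq_mul] at this
    exact sub_eq_zero.1 ((mul_eq_zero.1 this.symm).resolve_right hne)
  obtain rfl : k = 0 := hfst (by simp [← ht, hkt, ← Prod.zero_eq_mk])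
  simp [ht]

theorem InjectiveDifferentials.injective_fderiv_prod {K K' : Type*} [NormedAddCommGroup K]
    [NormedSpace ℂ K] [FiniteDimensional ℂ K] [NormedAddCommGroup K'] [NormedSpace ℂ K']
    (hK : InjectiveDifferentials K K') {f : K × ℂ → K' × ℂ} {U : Set (K × ℂ)} (hU : IsOpen U)
    (hf : DifferentiableOn ℂ f U) (hinj : InjOn f U) {p : K × ℂ} (hp : p ∈ U)
    (hne : (fderiv ℂ f p (0, 1)).2 ≠ 0) : Function.Injective (fderiv ℂ f p) := by
  have hfp : HasFDerivAt f (fderiv ℂ f p) p := (hf.differentiableAt (hU.mem_nhds hp)).hasFDerivAt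
  obtain ⟨ψ, hψ, hlevel⟩ := exists_implicit_graph (G := fun q ↦ (f q).2) hU hf.snd hp
    (by rwa [hfp.snd.fderiv])
  have hψp : ψ p.1 = p.2 := hlevel.self_of_nhds.1 rfl
  have hgraph : HasFDerivAt (fun k ↦ (k, ψ k)) ((ContinuousLinearMap.id ℂ K).prod (fderiv ℂ ψ p.1))
      p.1 := (hasFDerivAt_id _).prodMk hψ.self_of_nhds.hasFDerivAt
  have hfgraph : HasFDerivAt (fun k ↦ f (k, ψ k)) (fderiv ℂ f p ∘L
      (ContinuousLinearMap.id ℂ K).prod (fderiv ℂ ψ p.1)) p.1 :=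
    HasFDerivAt.comp (f := fun k ↦ (k, ψ k)) p.1 (by rwa [hψp]) hgraph
  have hnear : ∀ᶠ k in 𝓝 p.1, (k, ψ k) ∈ U ∧ (f (k, ψ k)).2 = (f p).2 :=
    (hgraph.continuousAt.eventually (p := fun q ↦ q ∈ U ∧ ((f q).2 = (f p).2 ↔ ψ q.1 = q.2))
      (by simpa only [hψp] using (hU.eventually_mem hp).and hlevel)).mono
        fun k hk ↦ ⟨hk.1, hk.2.2 rfl⟩
  obtain ⟨D, hD, hDo, hpD⟩ := _root_.eventually_nhds_iff.1 (hψ.and hnear)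
  -- On the graph of `ψ` the second component of `f` is constant, so the first one is injective.
  have hslice : Function.Injective (fderiv ℂ (fun k ↦ (f (k, ψ k)).1) p.1) := by
    refine hK hDo (fun k hk ↦ ?_) (fun k hk k' hk' hkk' ↦ ?_) p.1 hpD
    · exact ((hf.differentiableAt (hU.mem_nhds (hD k hk).2.1)).comp k (f := fun k ↦ (k, ψ k))
        (differentiableAt_id.prodMk (hD k hk).1)).fst.differentiableWithinAt
    · exact congrArg Prod.fst (hinj (hD k hk).2.1 (hD k' hk').2.1
        (Prod.ext hkk' ((hD k hk).2.2.trans (hD k' hk').2.2.symm)))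
  rw [hfgraph.fst.fderiv] at hslice
  refine injective_of_injective_fst_comp_graph hne (fun k ↦ ?_) hslice
  exact DFunLike.congr_fun (hfgraph.snd.unique ((hasFDerivAt_const (f p).2
    p.1).congr_of_eventuallyEq (hnear.mono fun k hk ↦ hk.2))) k

theorem exists_equiv_ker_prod {ℓ : E →L[ℂ] ℂ} {u : E} (hu : ℓ u = 1) :
    ∃ e : E ≃L[ℂ] ℓ.ker × ℂ, (∀ x, (e x).2 = ℓ x) ∧ e.symm (0, 1) = u := by
  refine ⟨(ContinuousLinearEquiv.equivOfRightInverse ℓ (ContinuousLinearMap.toSpanSingleton ℂ u)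
    fun t ↦ by simp [hu]).trans (ContinuousLinearEquiv.prodComm ℂ _ _), fun x ↦ rfl, ?_⟩
  simp

theorem injective_fderiv_of_fderiv_ne_zero [FiniteDimensional ℂ E] {f : E → F}
    (ih : ∀ (ℓ : E →L[ℂ] ℂ) (ℓ' : F →L[ℂ] ℂ), ℓ ≠ 0 → ℓ' ≠ 0 → InjectiveDifferentials ℓ.ker ℓ'.ker)
    {U : Set E} (hU : IsOpen U) (hf : DifferentiableOn ℂ f U)
    (hinj : InjOn f U) {a : E} (ha : a ∈ U) (hne : fderiv ℂ f a ≠ 0) :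
    Function.Injective (fderiv ℂ f a) := by
  obtain ⟨u, hu⟩ : ∃ u, fderiv ℂ f a u ≠ 0 := by simpa using DFunLike.ne_iff.1 hne
  obtain ⟨ℓ', hℓ'⟩ := SeparatingDual.exists_eq_one (R := ℂ) hu
  set ℓ : E →L[ℂ] ℂ := ℓ' ∘L fderiv ℂ f a
  have hℓ : ℓ u = 1 := hℓ'
  obtain ⟨e, -, hesymm⟩ := exists_equiv_ker_prod hℓ
  obtain ⟨e', he', -⟩ := exists_equiv_ker_prod hℓ'
  have hker : InjectiveDifferentials ℓ.ker ℓ'.ker := ih ℓ ℓ' (by rintro h; simp [h] at hℓ)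
    (by rintro rfl; simp at hℓ')
  refine injective_fderiv_of_equiv_comp_comp_equiv e e' (hker.injective_fderiv_prod (p := e a)
    (hU.preimage e.symm.continuous) (differentiableOn_equiv_comp_comp_equiv e e' hf)
    (injOn_equiv_comp_comp_equiv e e' hinj) (by simpa) ?_)
  rw [fderiv_equiv_comp_comp_equiv]
  simp [hesymm, he', hℓ']

theorem differentiableOn_det_fderiv [FiniteDimensional ℂ E] {f : E → E} {U : Set E}
    (hU : IsOpen U) (hf : DifferentiableOn ℂ f U) :
    DifferentiableOn ℂ (fun z ↦ (fderiv ℂ f z).det) U := by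
  set b := Module.finBasis ℂ E
  have hentry : ∀ i j, DifferentiableOn ℂ (fun z ↦ LinearMap.toMatrix b b (fderiv ℂ f z) i j) U :=
    fun i j ↦ by
      simp only [LinearMap.toMatrix_apply]
      exact (LinearMap.toContinuousLinearMap (b.coord i)).differentiable.comp_differentiableOn
        (differentiableOn_fderiv_apply hU hf (b j))
  simp only [ContinuousLinearMap.det, ← LinearMap.det_toMatrix b, Matrix.det_apply]
  exact DifferentiableOn.fun_sum fun σ _ ↦ DifferentiableOn.const_smul
    (fun z hz ↦ (HasFDerivWithinAt.finsetProd fun i _ ↦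
      (hentry (σ i) i z hz).hasFDerivWithinAt).differentiableWithinAt) _

theorem fderiv_ne_zero_of_injOn_of_two_le (hE : 2 ≤ Module.finrank ℂ E) {f : E → E} {U : Set E}
    (hU : IsOpen U) (hf : DifferentiableOn ℂ f U) (hinj : InjOn f U)
    (hrank : ∀ z ∈ U, fderiv ℂ f z ≠ 0 → Function.Injective (fderiv ℂ f z)) {a : E} (ha : a ∈ U) :
    fderiv ℂ f a ≠ 0 := by
  intro hfa
  have hpos : 0 < Module.finrank ℂ E := by omega
  have : FiniteDimensional ℂ E := Module.finite_of_finrank_pos hpos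
  have : Nontrivial E := Module.nontrivial_of_finrank_pos hpos
  have hdet : ∀ z ∈ U, (fderiv ℂ f z).det = 0 → fderiv ℂ f z = 0 := fun z hz hJz ↦ by
    by_contra hne
    exact (LinearMap.isUnit_iff_isUnit_det _).1 ((LinearMap.isUnit_iff_ker_eq_bot _).2
      (LinearMap.ker_eq_bot.2 (hrank z hz hne))) |>.ne_zero hJz
  have hdeta : (fderiv ℂ f a).det = 0 := by
    simp [hfa, ContinuousLinearMap.det]
  obtain ⟨c, D, hD, ⟨x, hx⟩, hc, hcinj, hcD⟩ := exists_curve_subset_zeros hE hU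
    (differentiableOn_det_fderiv hU hf) ha hdeta fun hzero ↦
      not_eventually_fderiv_eq_zero hU hf hinj ha
        ((hzero.and (hU.eventually_mem ha)).mono fun z hz ↦ hdet z hz.2 hz.1)
  refine not_eventually_fderiv_eq_zero hD (hf.comp hc fun y hy ↦ (hcD hy).1)
    (hinj.comp hcinj fun y hy ↦ (hcD hy).1) hx ((hD.eventually_mem hx).mono fun y hy ↦ ?_)
  rw [fderiv_comp y (hf.differentiableAt (hU.mem_nhds (hcD hy).1))
    (hc.differentiableAt (hD.mem_nhds hy)), hdet _ (hcD hy).1 (hcD hy).2,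
    ContinuousLinearMap.zero_comp]

theorem injectiveDifferentials_self (E : Type*) [NormedAddCommGroup E] [NormedSpace ℂ E]
    [FiniteDimensional ℂ E] : InjectiveDifferentials E E := by
  induction hn : Module.finrank ℂ E using Nat.strong_induction_on generalizing E with
  | _ n ih =>
  intro f U hU hf hinj a ha
  rcases lt_trichotomy n 1 with hlt | rfl | hlt
  · have : Subsingleton E := Module.finrank_zero_iff.1 (hn.trans (Nat.lt_one_iff.1 hlt))
    exact Function.injective_of_subsingleton _
  · let e : E ≃L[ℂ] ℂ := ContinuousLinearEquiv.ofFinrankEq (by rw [hn, Module.finrank_self])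
    exact injectiveDifferentials_complex.congr e e hU hf hinj a ha
  · have hker : ∀ ℓ : E →L[ℂ] ℂ, ℓ ≠ 0 → Module.finrank ℂ ℓ.ker + 1 = n := fun ℓ hℓ ↦
      (Module.Dual.finrank_ker_add_one_of_ne_zero
        fun h ↦ hℓ (ContinuousLinearMap.coe_injective h)).trans hn
    have hrank : ∀ z ∈ U, fderiv ℂ f z ≠ 0 → Function.Injective (fderiv ℂ f z) := fun z hz ↦
      injective_fderiv_of_fderiv_ne_zero (fun ℓ ℓ' hℓ hℓ' ↦
        (ih _ (by have := hker ℓ hℓ; omega) ℓ.ker rfl).congr (.refl ℂ _)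
          (.ofFinrankEq (by have := hker ℓ hℓ; have := hker ℓ' hℓ'; omega))) hU hf hinj hz
    exact hrank a ha (fderiv_ne_zero_of_injOn_of_two_le (by omega) hU hf hinj hrank ha)

theorem injectiveDifferentials_of_finrank_eq [FiniteDimensional ℂ E] [FiniteDimensional ℂ F]
    (hEF : Module.finrank ℂ E = Module.finrank ℂ F) : InjectiveDifferentials E F :=
  (injectiveDifferentials_self E).congr (.refl ℂ E) (.ofFinrankEq hEF.symm)

end Osgood

section HolomorphicLift

variable {E F G : Type*} [NormedAddCommGroup E] [NormedSpace ℂ E]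
  [NormedAddCommGroup F] [NormedSpace ℂ F] [FiniteDimensional ℂ F]
  [NormedAddCommGroup G] [NormedSpace ℂ G]

theorem exists_differentiableAt_right_inverse [FiniteDimensional ℂ E]
    (hEF : Module.finrank ℂ E = Module.finrank ℂ F) {g : E → F} {U : Set E} (hU : IsOpen U)
    (hg : DifferentiableOn ℂ g U) (hinj : InjOn g U) {a : E} (ha : a ∈ U) :
    ∃ φ : F → E, φ (g a) = a ∧ DifferentiableAt ℂ φ (g a) ∧ ∀ᶠ y in 𝓝 (g a), g (φ y) = y := by
  let e : E ≃L[ℂ] F := (LinearEquiv.ofInjectiveOfFinrankEq (fderiv ℂ g a : E →ₗ[ℂ] F)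
    (injectiveDifferentials_of_finrank_eq hEF hU hg hinj a ha) hEF).toContinuousLinearEquiv
  have hge : HasFDerivAt g (e : E →L[ℂ] F) a :=
    (hg.differentiableAt (hU.mem_nhds ha)).hasFDerivAt
  have hgc : ContDiffAt ℂ 1 g a := contDiffAt_one_of_holomorphicOn hU hg ha
  exact ⟨hgc.localInverse hge one_ne_zero, hgc.localInverse_apply_image hge one_ne_zero,
    (hgc.to_localInverse hge one_ne_zero).differentiableAt one_ne_zero,
    (hgc.hasStrictFDerivAt' hge one_ne_zero).eventually_right_inverse⟩

theorem exists_holomorphic_lift [FiniteDimensional ℂ E]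
    (hEF : Module.finrank ℂ E = Module.finrank ℂ F) {f : G → F} {g : E → F} {U : Set E}
    {V : Set G} (hU : IsOpen U) (hV : IsOpen V) (hf : DifferentiableOn ℂ f V)
    (hg : DifferentiableOn ℂ g U) (hinj : InjOn g U) (hsub : f '' V ⊆ g '' U) :
    ∃ v : G → E, DifferentiableOn ℂ v V ∧ MapsTo v V U ∧ ∀ z ∈ V, g (v z) = f z := by
  have hlift : ∀ z ∈ V, ∃ w ∈ U, g w = f z := fun z hz ↦ hsub (mem_image_of_mem f hz)
  choose! v hvU hgv using hlift
  refine ⟨v, fun z hz ↦ DifferentiableAt.differentiableWithinAt ?_, hvU, hgv⟩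
  obtain ⟨φ, hφz, hφ, hright⟩ := exists_differentiableAt_right_inverse hEF hU hg hinj (hvU z hz)
  rw [hgv z hz] at hφz hφ hright
  have hfz : DifferentiableAt ℂ f z := hf.differentiableAt (hV.mem_nhds hz)
  have hφU : ∀ᶠ y in 𝓝 (f z), φ y ∈ U :=
    hφ.continuousAt.eventually (hU.eventually_mem (hφz.symm ▸ hvU z hz))
  refine (hφ.comp z hfz).congr_of_eventuallyEq ?_
  filter_upwards [hfz.continuousAt.eventually (hright.and hφU), hV.eventually_mem hz]
    with y ⟨hy, hyU⟩ hyV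
  exact hinj (hvU y hyV) hyU ((hgv y hyV).trans hy.symm)

end HolomorphicLift

section SchwarzPick

open scoped ComplexConjugate

/-- The automorphism `u ↦ (u + b) / (1 + b̄ u)` of the unit disc, which takes `0` to `b`. -/
noncomputable def discAut (b u : ℂ) : ℂ := (u + b) / (1 + conj b * u)

theorem one_add_conj_mul_ne_zero {b u : ℂ} (hb : ‖b‖ < 1) (hu : ‖u‖ ≤ 1) :
    1 + conj b * u ≠ 0 := by
  intro h
  have hnorm : ‖b‖ * ‖u‖ = 1 := by
    rw [← RCLike.norm_conj b, ← norm_mul, eq_neg_of_add_eq_zero_right h, norm_neg, norm_one]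
  nlinarith [norm_nonneg b]

theorem sq_norm_one_add_conj_mul_sub (b u : ℂ) :
    ‖1 + conj b * u‖ ^ 2 - ‖u + b‖ ^ 2 = (1 - ‖b‖ ^ 2) * (1 - ‖u‖ ^ 2) := by
  simp only [← Complex.normSq_eq_norm_sq, Complex.normSq_apply]
  simp
  ring

theorem norm_discAut_le_one {b u : ℂ} (hb : ‖b‖ < 1) (hu : ‖u‖ ≤ 1) : ‖discAut b u‖ ≤ 1 := by
  rw [discAut, norm_div, div_le_one (norm_pos_iff.2 (one_add_conj_mul_ne_zero hb hu))]
  refine le_of_sq_le_sq (sub_nonneg.1 ?_) (norm_nonneg _)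
  rw [sq_norm_one_add_conj_mul_sub]
  exact mul_nonneg (sub_nonneg.2 (pow_le_one₀ (norm_nonneg _) hb.le))
    (sub_nonneg.2 (pow_le_one₀ (norm_nonneg _) hu))

theorem norm_discAut_lt_one {b u : ℂ} (hb : ‖b‖ < 1) (hu : ‖u‖ < 1) : ‖discAut b u‖ < 1 := by
  rw [discAut, norm_div, div_lt_one (norm_pos_iff.2 (one_add_conj_mul_ne_zero hb hu.le))]
  refine lt_of_pow_lt_pow_left₀ 2 (norm_nonneg _) (sub_pos.1 ?_)
  rw [sq_norm_one_add_conj_mul_sub]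
  exact mul_pos (sub_pos.2 (pow_lt_one₀ (norm_nonneg _) hb two_ne_zero))
    (sub_pos.2 (pow_lt_one₀ (norm_nonneg _) hu two_ne_zero))

theorem norm_discAut_le {b u : ℂ} (hb : ‖b‖ < 1) (hu : ‖u‖ ≤ 1) :
    ‖discAut b u‖ ≤ (‖b‖ + ‖u‖) / (1 + ‖b‖ * ‖u‖) := by
  rw [discAut, norm_div, div_le_div_iff₀ (norm_pos_iff.2 (one_add_conj_mul_ne_zero hb hu))
    (by positivity)]
  refine le_of_sq_le_sq ?_ (by positivity)
  have hid := sq_norm_one_add_conj_mul_sub b u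
  have htri : ‖u + b‖ ^ 2 ≤ (‖b‖ + ‖u‖) ^ 2 := by
    rw [add_comm ‖b‖]
    exact pow_le_pow_left₀ (norm_nonneg _) (norm_add_le u b) 2
  have hdefect : 0 ≤ (1 - ‖b‖ ^ 2) * (1 - ‖u‖ ^ 2) :=
    mul_nonneg (sub_nonneg.2 (pow_le_one₀ (norm_nonneg _) hb.le))
      (sub_nonneg.2 (pow_le_one₀ (norm_nonneg _) hu))
  calc (‖u + b‖ * (1 + ‖b‖ * ‖u‖)) ^ 2
      = ‖u + b‖ ^ 2 * (‖b‖ + ‖u‖) ^ 2 + ‖u + b‖ ^ 2 * ((1 - ‖b‖ ^ 2) * (1 - ‖u‖ ^ 2)) := by ring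
    _ ≤ ‖u + b‖ ^ 2 * (‖b‖ + ‖u‖) ^ 2 +
        (‖b‖ + ‖u‖) ^ 2 * ((1 - ‖b‖ ^ 2) * (1 - ‖u‖ ^ 2)) := by gcongr
    _ = ((‖b‖ + ‖u‖) * ‖1 + conj b * u‖) ^ 2 := by rw [← hid]; ring

theorem discAut_discAut_neg {b u : ℂ} (hb : ‖b‖ < 1) (hu : ‖u‖ ≤ 1) :
    discAut b (discAut (-b) u) = u := by
  have hb' : ‖-b‖ < 1 := by rwa [norm_neg]
  have hcancel : discAut (-b) u * (1 + conj (-b) * u) = u + -b :=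
    div_mul_cancel₀ _ (one_add_conj_mul_ne_zero hb' hu)
  rw [discAut, div_eq_iff (one_add_conj_mul_ne_zero hb (norm_discAut_le_one hb' hu))]
  rw [map_neg] at hcancel
  linear_combination hcancel

theorem differentiableOn_discAut {b : ℂ} (hb : ‖b‖ < 1) :
    DifferentiableOn ℂ (discAut b) (closedBall 0 1) :=
  DifferentiableOn.div (by fun_prop) (by fun_prop)
    fun _ hu ↦ one_add_conj_mul_ne_zero hb (mem_closedBall_zero_iff.1 hu)

theorem discAut_zero (b : ℂ) : discAut b 0 = b := by simp [discAut]

theorem discAut_neg_self (b : ℂ) : discAut (-b) b = 0 := by simp [discAut]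

theorem hasDerivAt_discAut_zero (b : ℂ) : HasDerivAt (discAut b) (1 - ‖b‖ ^ 2 : ℝ) 0 := by
  have hden : HasDerivAt (fun u ↦ 1 + conj b * u) (conj b) 0 := by
    simpa using ((hasDerivAt_id (0 : ℂ)).const_mul (conj b)).const_add 1
  refine (((hasDerivAt_id (0 : ℂ)).add_const b).div hden (by simp)).congr_deriv ?_
  simp [Complex.mul_conj']

theorem add_div_one_add_mul_le_add_div_one_add_mul {a b r : ℝ} (hb : 0 ≤ b) (hba : b ≤ a)
    (hr0 : 0 ≤ r) (hr : r ≤ 1) : (b + r) / (1 + b * r) ≤ (a + r) / (1 + a * r) := by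
  have ha : 0 ≤ a := hb.trans hba
  rw [div_le_div_iff₀ (by positivity) (by positivity)]
  nlinarith [mul_nonneg (sub_nonneg.2 hba) (sub_nonneg.2 (pow_le_one₀ hr0 hr (n := 2)))]

theorem norm_le_of_forall_mem_ball_norm_le_one {p : ℂ → ℂ} (hd : DifferentiableOn ℂ p (ball 0 1))
    (hp : ∀ ζ ∈ ball (0 : ℂ) 1, ‖p ζ‖ ≤ 1) {a : ℝ} (ha : a < 1) (hpa : ‖p 0‖ ≤ a) {ζ : ℂ}
    (hζ : ‖ζ‖ < 1) : ‖p ζ‖ ≤ (a + ‖ζ‖) / (1 + a * ‖ζ‖) := by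
  have hp0 : ‖p 0‖ < 1 := hpa.trans_lt ha
  have hp0' : ‖-p 0‖ < 1 := by rwa [norm_neg]
  have hm : ‖discAut (-p 0) (p ζ)‖ ≤ ‖ζ‖ :=
    Complex.norm_le_norm_of_mapsTo_ball
      ((differentiableOn_discAut hp0').comp hd fun ξ hξ ↦ mem_closedBall_zero_iff.2 (hp ξ hξ))
      (fun ξ hξ ↦ mem_closedBall_zero_iff.2 (norm_discAut_le_one hp0' (hp ξ hξ)))
      (discAut_neg_self _) hζ
  set m := discAut (-p 0) (p ζ)
  have hpm : p ζ = discAut (p 0) m :=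
    (discAut_discAut_neg hp0 (hp ζ (mem_ball_zero_iff.2 hζ))).symm
  calc ‖p ζ‖ ≤ (‖p 0‖ + ‖m‖) / (1 + ‖p 0‖ * ‖m‖) := hpm ▸ norm_discAut_le hp0 (hm.trans hζ.le)
    _ = (‖m‖ + ‖p 0‖) / (1 + ‖m‖ * ‖p 0‖) := by rw [add_comm, mul_comm]
    _ ≤ (‖ζ‖ + ‖p 0‖) / (1 + ‖ζ‖ * ‖p 0‖) :=
      add_div_one_add_mul_le_add_div_one_add_mul (norm_nonneg _) hm (norm_nonneg _) hp0.le
    _ = (‖p 0‖ + ‖ζ‖) / (1 + ‖p 0‖ * ‖ζ‖) := by rw [add_comm, mul_comm]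
    _ ≤ (a + ‖ζ‖) / (1 + a * ‖ζ‖) :=
      add_div_one_add_mul_le_add_div_one_add_mul (norm_nonneg _) hpa (norm_nonneg _) hζ.le

theorem norm_le_of_norm_deriv_zero_le {h : ℂ → ℂ} (hd : DifferentiableOn ℂ h (ball 0 1))
    (hmaps : MapsTo h (ball 0 1) (closedBall 0 1)) (h0 : h 0 = 0) {a : ℝ} (ha : a < 1)
    (hda : ‖deriv h 0‖ ≤ a) {ζ : ℂ} (hζ : ‖ζ‖ < 1) :
    ‖h ζ‖ ≤ ‖ζ‖ * ((a + ‖ζ‖) / (1 + a * ‖ζ‖)) := by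
  have hslope : ‖dslope h 0 ζ‖ ≤ (a + ‖ζ‖) / (1 + a * ‖ζ‖) := by
    refine norm_le_of_forall_mem_ball_norm_le_one
      ((Complex.differentiableOn_dslope (ball_mem_nhds _ one_pos)).2 hd) (fun ξ hξ ↦ ?_) ha
      (by rwa [dslope_same]) hζ
    simpa using Complex.norm_dslope_le_div_of_mapsTo_ball hd (h0.symm ▸ hmaps) hξ
  have hfactor : h ζ = ζ * dslope h 0 ζ := by
    simpa [h0] using (sub_smul_dslope h 0 ζ).symm
  rw [hfactor, norm_mul]
  gcongr

variable {E F : Type*} [NormedAddCommGroup E] [NormedSpace ℂ E]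
  [NormedAddCommGroup F] [NormedSpace ℂ F]

theorem norm_le_of_norm_fderiv_zero_le {v : E → F} (hd : DifferentiableOn ℂ v (ball 0 1))
    (hmaps : MapsTo v (ball 0 1) (closedBall 0 1)) (hv0 : v 0 = 0) {a : ℝ} (ha : a < 1)
    (hda : ‖fderiv ℂ v 0‖ ≤ a) {z : E} (hz : ‖z‖ < 1) :
    ‖v z‖ ≤ ‖z‖ * ((a + ‖z‖) / (1 + a * ‖z‖)) := by
  rcases eq_or_ne z 0 with rfl | hz0
  · simp [hv0]
  set u : E := (‖z‖ : ℂ)⁻¹ • z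
  have hu : ‖u‖ = 1 := norm_smul_inv_norm hz0
  have hzu : (‖z‖ : ℂ) • u = z := smul_inv_smul₀ (by simpa using hz0) z
  obtain ⟨w, hw, hwv⟩ := exists_dual_vector'' ℂ (v z)
  have hline : MapsTo (fun ζ : ℂ ↦ ζ • u) (ball 0 1) (ball 0 1) := fun ζ hζ ↦ by
    simpa [norm_smul, hu] using hζ
  have hderiv : HasDerivAt (fun ζ : ℂ ↦ w (v (ζ • u))) (w (fderiv ℂ v 0 u)) 0 := by
    have hv : HasFDerivAt v (fderiv ℂ v 0) ((0 : ℂ) • u) := by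
      rw [zero_smul]
      exact (hd.differentiableAt (ball_mem_nhds _ one_pos)).hasFDerivAt
    exact (w.hasFDerivAt.comp_hasDerivAt 0 (hv.comp_hasDerivAt 0
      ((hasDerivAt_id (0 : ℂ)).smul_const u))).congr_deriv (by simp)
  have hderivle : ‖deriv (fun ζ : ℂ ↦ w (v (ζ • u))) 0‖ ≤ a := by
    rw [hderiv.deriv]
    calc ‖w (fderiv ℂ v 0 u)‖ ≤ 1 * ‖fderiv ℂ v 0 u‖ := w.le_of_opNorm_le hw _
      _ = ‖fderiv ℂ v 0 u‖ := one_mul _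
      _ ≤ ‖fderiv ℂ v 0‖ := (fderiv ℂ v 0).unit_le_opNorm u hu.le
      _ ≤ a := hda
  have key := norm_le_of_norm_deriv_zero_le (h := fun ζ ↦ w (v (ζ • u)))
    (w.differentiable.comp_differentiableOn (hd.comp (by fun_prop) hline)) (fun ζ hζ ↦ ?_)
    (by simp [hv0]) ha hderivle (ζ := (‖z‖ : ℝ)) (by simpa using hz)
  · simpa [hzu, hwv] using key
  · exact mem_closedBall_zero_iff.2 ((w.le_of_opNorm_le_of_le hw
      (mem_closedBall_zero_iff.1 (hmaps (hline hζ)))).trans_eq (one_mul 1))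

theorem norm_deriv_le_of_forall_mem_ball {h : ℂ → F} {c : ℂ} {ρ M : ℝ} (hρ : 0 < ρ)
    (hd : DifferentiableOn ℂ h (ball c ρ)) (hM : ∀ ζ ∈ ball c ρ, ‖h ζ‖ ≤ M) :
    ‖deriv h c‖ ≤ M / ρ := by
  have hcauchy : ∀ s ∈ Ioo 0 ρ, ‖deriv h c‖ ≤ M / s := fun s hs ↦
    Complex.norm_deriv_le_of_forall_mem_sphere_norm_le hs.1
      ((hd.mono (closedBall_subset_ball hs.2)).diffContOnCl_ball subset_rfl)
      fun u hu ↦ hM u (closedBall_subset_ball hs.2 (sphere_subset_closedBall hu))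
  refine ge_of_tendsto (x := 𝓝[<] ρ) ?_ (eventually_of_mem (Ioo_mem_nhdsLT hρ) hcauchy)
  exact (continuousAt_const.div continuousAt_id hρ.ne').tendsto.mono_left nhdsWithin_le_nhds

theorem norm_deriv_mul_one_sub_sq_le {h : ℂ → F} {M : ℝ} {b : ℂ}
    (hd : DifferentiableOn ℂ h (ball 0 1)) (hM : ∀ ζ ∈ ball (0 : ℂ) 1, ‖h ζ‖ ≤ M)
    (hb : ‖b‖ < 1) : ‖deriv h b‖ * (1 - ‖b‖ ^ 2) ≤ M := by
  have hmaps : MapsTo (discAut b) (ball 0 1) (ball 0 1) := fun u hu ↦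
    mem_ball_zero_iff.2 (norm_discAut_lt_one hb (mem_ball_zero_iff.1 hu))
  have hderiv : HasDerivAt (h ∘ discAut b) ((1 - ‖b‖ ^ 2 : ℝ) • deriv h b) 0 := by
    refine HasDerivAt.scomp (0 : ℂ) ?_ (hasDerivAt_discAut_zero b)
    rw [discAut_zero]
    exact (hd.differentiableAt (isOpen_ball.mem_nhds (mem_ball_zero_iff.2 hb))).hasDerivAt
  have hle := norm_deriv_le_of_forall_mem_ball one_pos
    (hd.comp ((differentiableOn_discAut hb).mono ball_subset_closedBall) hmaps)
    fun u hu ↦ hM _ (hmaps hu)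
  rwa [hderiv.deriv, norm_smul, Real.norm_of_nonneg
    (sub_nonneg.2 (pow_le_one₀ (norm_nonneg _) hb.le)), mul_comm, div_one] at hle

theorem norm_deriv_mul_le_of_forall_mem_ball {h : ℂ → F} {ρ M : ℝ} {b : ℂ}
    (hd : DifferentiableOn ℂ h (ball 0 ρ)) (hM : ∀ ζ ∈ ball (0 : ℂ) ρ, ‖h ζ‖ ≤ M)
    (hb : ‖b‖ < ρ) : ‖deriv h b‖ * (ρ ^ 2 - ‖b‖ ^ 2) ≤ M * ρ := by
  have hρ : 0 < ρ := (norm_nonneg _).trans_lt hb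
  have hmaps : MapsTo (fun u : ℂ ↦ (ρ : ℂ) * u) (ball 0 1) (ball 0 ρ) := fun u hu ↦ by
    rw [mem_ball_zero_iff] at hu ⊢
    rw [norm_mul, Complex.norm_of_nonneg hρ.le]
    exact mul_lt_of_lt_one_right hρ hu
  have hle := norm_deriv_mul_one_sub_sq_le (hd.comp (by fun_prop) hmaps)
    (fun u hu ↦ hM _ (hmaps hu)) (b := b / ρ)
    (by rwa [norm_div, Complex.norm_of_nonneg hρ.le, div_lt_one hρ])
  rw [show h ∘ (fun u : ℂ ↦ (ρ : ℂ) * u) = fun u ↦ h (ρ * u) from rfl, deriv_comp_mul_left,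
    mul_div_cancel₀ _ (Complex.ofReal_ne_zero.2 hρ.ne'), norm_smul, norm_div,
    Complex.norm_of_nonneg hρ.le] at hle
  calc ‖deriv h b‖ * (ρ ^ 2 - ‖b‖ ^ 2) = ρ * ‖deriv h b‖ * (1 - (‖b‖ / ρ) ^ 2) * ρ := by
        field_simp
    _ ≤ M * ρ := by gcongr

variable {H : Type*} [NormedAddCommGroup H] [InnerProductSpace ℂ H]

theorem sq_norm_add_smul_of_inner_eq_zero {v w : H} (hv : ‖v‖ = 1) (hwv : inner ℂ w v = 0)
    (ζ : ℂ) : ‖w + ζ • v‖ ^ 2 = ‖w‖ ^ 2 + ‖ζ‖ ^ 2 := by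
  have horth : inner ℂ w (ζ • v) = 0 := by rw [inner_smul_right, hwv, mul_zero]
  simpa [norm_smul, hv, ← sq] using
    norm_add_sq_eq_norm_sq_add_norm_sq_of_inner_eq_zero w (ζ • v) horth

theorem norm_fderiv_apply_mul_le_of_inner_eq_zero {f : H → F} {R M : ℝ} {v w : H}
    (hd : DifferentiableOn ℂ f (ball 0 R)) (hM : ∀ y ∈ ball (0 : H) R, ‖f y‖ ≤ M) (hv : ‖v‖ = 1)
    (hwv : inner ℂ w v = 0) {b : ℂ} (hb : ‖w + b • v‖ < R) :
    ‖fderiv ℂ f (w + b • v) v‖ * (R ^ 2 - ‖w + b • v‖ ^ 2) ≤ M * R := by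
  have hR : 0 < R := (norm_nonneg _).trans_lt hb
  have hM0 : 0 ≤ M := (norm_nonneg _).trans (hM 0 (mem_ball_self hR))
  have hnorm := sq_norm_add_smul_of_inner_eq_zero hv hwv
  have hbR : ‖w‖ ^ 2 + ‖b‖ ^ 2 < R ^ 2 := hnorm b ▸ pow_lt_pow_left₀ hb (norm_nonneg _) two_ne_zero
  -- The complex line `w + ℂ v` meets the ball of radius `R` in a disc of radius `ρ`.
  set ρ := √(R ^ 2 - ‖w‖ ^ 2)
  have hρ : ρ ^ 2 = R ^ 2 - ‖w‖ ^ 2 := Real.sq_sqrt (by nlinarith)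
  have hbρ : ‖b‖ < ρ := Real.lt_sqrt_of_sq_lt (by linarith)
  have hρR : ρ ≤ R := Real.sqrt_le_iff.2 ⟨hR.le, by nlinarith⟩
  have hline : MapsTo (fun ζ : ℂ ↦ w + ζ • v) (ball 0 ρ) (ball 0 R) := fun ζ hζ ↦ by
    have hζρ : ‖ζ‖ ^ 2 < ρ ^ 2 :=
      pow_lt_pow_left₀ (mem_ball_zero_iff.1 hζ) (norm_nonneg _) two_ne_zero
    exact mem_ball_zero_iff.2 (lt_of_pow_lt_pow_left₀ 2 hR.le (by linarith [hnorm ζ]))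
  have hderiv : HasDerivAt (fun ζ : ℂ ↦ f (w + ζ • v)) (fderiv ℂ f (w + b • v) v) b := by
    refine HasFDerivAt.comp_hasDerivAt b
      (hd.differentiableAt (isOpen_ball.mem_nhds (mem_ball_zero_iff.2 hb))).hasFDerivAt ?_
    simpa using ((hasDerivAt_id b).smul_const v).const_add w
  calc ‖fderiv ℂ f (w + b • v) v‖ * (R ^ 2 - ‖w + b • v‖ ^ 2)
      = ‖deriv (fun ζ : ℂ ↦ f (w + ζ • v)) b‖ * (ρ ^ 2 - ‖b‖ ^ 2) := by
        rw [hderiv.deriv, hnorm, hρ, sub_sub]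
    _ ≤ M * ρ := norm_deriv_mul_le_of_forall_mem_ball (hd.comp (by fun_prop) hline)
        (fun ζ hζ ↦ hM _ (hline hζ)) hbρ
    _ ≤ M * R := by gcongr

theorem norm_fderiv_mul_le_of_forall_mem_ball {f : H → F} {R M : ℝ} {z : H}
    (hd : DifferentiableOn ℂ f (ball 0 R)) (hM : ∀ y ∈ ball (0 : H) R, ‖f y‖ ≤ M)
    (hz : ‖z‖ < R) : ‖fderiv ℂ f z‖ * (R ^ 2 - ‖z‖ ^ 2) ≤ M * R := by
  have hR : 0 < R := (norm_nonneg _).trans_lt hz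
  have hM0 : 0 ≤ M := (norm_nonneg _).trans (hM 0 (mem_ball_self hR))
  have hpos : 0 < R ^ 2 - ‖z‖ ^ 2 :=
    sub_pos.2 (pow_lt_pow_left₀ hz (norm_nonneg _) two_ne_zero)
  rw [← le_div_iff₀ hpos]
  refine ContinuousLinearMap.opNorm_le_of_unit_norm (𝕜 := ℂ) (by positivity) fun v hv ↦ ?_
  rw [le_div_iff₀ hpos]
  have horth : inner ℂ (z - inner ℂ v z • v) v = 0 := by
    rw [inner_sub_left, inner_smul_left, inner_conj_symm, inner_self_eq_norm_sq_to_K, hv]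
    simp
  have key := norm_fderiv_apply_mul_le_of_inner_eq_zero hd hM hv horth (b := inner ℂ v z)
    (by rwa [sub_add_cancel])
  rwa [sub_add_cancel] at key

end SchwarzPick

section Koebe

/-- The radial part `x / (1 - x) ^ 2` of the Koebe function, extremal for the growth of univalent
functions. -/
noncomputable def koebe (x : ℝ) : ℝ := x / (1 - x) ^ 2

theorem koebe_nonneg {x : ℝ} (hx : 0 ≤ x) : 0 ≤ koebe x := by
  unfold koebe
  positivity

theorem koebe_le_koebe {x y : ℝ} (hx : 0 ≤ x) (hxy : x ≤ y) (hy : y < 1) : koebe x ≤ koebe y := by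
  have : 0 < 1 - y := sub_pos.2 hy
  have : 0 ≤ y := hx.trans hxy
  unfold koebe
  gcongr

theorem le_koebe {x : ℝ} (hx0 : 0 ≤ x) (hx1 : x < 1) : x ≤ koebe x :=
  (le_div_iff₀ (pow_pos (sub_pos.2 hx1) 2)).2
    (mul_le_of_le_one_right hx0 (pow_le_one₀ (sub_nonneg.2 hx1.le) (sub_le_self 1 hx0)))

theorem koebe_mul_add_div_le {a r : ℝ} (ha : 0 ≤ a) (hr0 : 0 ≤ r) (hr1 : r < 1) :
    koebe (r * ((a + r) / (1 + a * r))) ≤ ((1 + a) / 2) ^ 2 * koebe r := by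
  have : 0 < 1 + a * r := by positivity
  have hsub : 0 < 1 - r := sub_pos.2 hr1
  have hone : 1 - r * ((a + r) / (1 + a * r)) = (1 - r) * (1 + r) / (1 + a * r) := by
    field_simp
    ring
  calc koebe (r * ((a + r) / (1 + a * r)))
      = (a + r) * (1 + a * r) / (1 + r) ^ 2 * koebe r := by
        rw [koebe, hone, koebe]
        field_simp
    _ ≤ ((1 + a) / 2) ^ 2 * koebe r := by
        gcongr
        · exact koebe_nonneg hr0
        · rw [div_le_iff₀ (by positivity)]
          linarith [four_mul_le_sq_add (a + r) (1 + a * r)]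

theorem half_one_add_exp_neg_le (τ : ℝ) :
    (1 + Real.exp (-τ)) / 2 ≤ Real.exp (-τ / 2 + τ ^ 2 / 8) := by
  calc (1 + Real.exp (-τ)) / 2 = Real.exp (-τ / 2) * Real.cosh (τ / 2) := by
        rw [Real.cosh_eq, mul_div_assoc', mul_add, ← Real.exp_add, ← Real.exp_add]
        ring_nf
        simp [add_comm]
    _ ≤ Real.exp (-τ / 2) * Real.exp ((τ / 2) ^ 2 / 2) := by
        gcongr
        exact Real.cosh_le_exp_half_sq _
    _ = Real.exp (-τ / 2 + τ ^ 2 / 8) := by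
        rw [← Real.exp_add]
        ring_nf

theorem sq_half_one_add_exp_neg_pow_le (t : ℝ) (N : ℕ) :
    (((1 + Real.exp (-(t / (N + 1)))) / 2) ^ 2) ^ (N + 1) ≤
      Real.exp (-t + t ^ 2 / 4 * (1 / (N + 1))) := by
  calc (((1 + Real.exp (-(t / (N + 1)))) / 2) ^ 2) ^ (N + 1)
      ≤ (Real.exp (-(t / (N + 1)) / 2 + (t / (N + 1)) ^ 2 / 8) ^ 2) ^ (N + 1) := by
        gcongr
        exact half_one_add_exp_neg_le _
    _ = Real.exp (-t + t ^ 2 / 4 * (1 / (N + 1))) := by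
        rw [← Real.exp_nat_mul, ← Real.exp_nat_mul]
        congr 1
        push_cast
        field_simp
        ring

end Koebe

section LoewnerChain

variable {n : ℕ} {F : ℝ≥0 → Cn n → Cn n}

theorem eq_exp_smul_rescaled (F : ℝ≥0 → Cn n → Cn n) (t : ℝ≥0) :
    F t = fun z ↦ Real.exp t • rescaled F t z := by
  funext z
  rw [rescaled, smul_smul, ← Real.exp_add, add_neg_cancel, Real.exp_zero, one_smul]

theorem IsNormalizedUnivalent.hasFDerivAt_zero {f : Cn n → Cn n} (hf : IsNormalizedUnivalent f) :
    HasFDerivAt f (ContinuousLinearMap.id ℂ (Cn n)) 0 := by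
  rw [← hf.fderiv_zero]
  exact (hf.holomorphic.differentiableAt (ball_mem_nhds _ one_pos)).hasFDerivAt

theorem IsLoewnerChain.differentiableOn (h : IsLoewnerChain F) (t : ℝ≥0) :
    DifferentiableOn ℂ (F t) (unitBall n) := by
  rw [eq_exp_smul_rescaled F t]
  exact (h.normalized t).holomorphic.const_smul (Real.exp t)

theorem IsLoewnerChain.injOn (h : IsLoewnerChain F) (t : ℝ≥0) : InjOn (F t) (unitBall n) :=
  fun _ hx _ hy hxy ↦ (h.normalized t).univalent hx hy (by simp only [rescaled, hxy])

theorem IsLoewnerChain.map_zero (h : IsLoewnerChain F) (t : ℝ≥0) : F t 0 = 0 := by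
  rw [eq_exp_smul_rescaled F t]
  simp only [(h.normalized t).map_zero, smul_zero]

theorem IsLoewnerChain.hasFDerivAt_zero (h : IsLoewnerChain F) (t : ℝ≥0) :
    HasFDerivAt (F t) (Real.exp t • ContinuousLinearMap.id ℂ (Cn n)) 0 := by
  rw [eq_exp_smul_rescaled F t]
  exact (h.normalized t).hasFDerivAt_zero.const_smul (Real.exp t)

theorem IsLoewnerChain.exists_transition (h : IsLoewnerChain F) {s t : ℝ≥0} (hst : s ≤ t) :
    ∃ v : Cn n → Cn n, DifferentiableOn ℂ v (unitBall n) ∧ MapsTo v (unitBall n) (unitBall n) ∧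
      (∀ z ∈ unitBall n, F t (v z) = F s z) ∧ v 0 = 0 ∧
      fderiv ℂ v 0 = Real.exp (s - t) • ContinuousLinearMap.id ℂ (Cn n) := by
  obtain ⟨v, hvd, hmaps, hv⟩ := exists_holomorphic_lift rfl isOpen_ball isOpen_ball
    (h.differentiableOn s) (h.differentiableOn t) (h.injOn t) (h.image_subset s t hst)
  have h0 : (0 : Cn n) ∈ unitBall n := mem_ball_self one_pos
  have hv0 : v 0 = 0 := h.injOn t (hmaps h0) h0 (by rw [hv 0 h0, h.map_zero, h.map_zero])
  refine ⟨v, hvd, hmaps, hv, hv0, ?_⟩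
  have hcomp : HasFDerivAt (F t ∘ v)
      ((Real.exp t • ContinuousLinearMap.id ℂ (Cn n)) ∘L fderiv ℂ v 0) 0 :=
    HasFDerivAt.comp 0 (hv0.symm ▸ h.hasFDerivAt_zero t)
      (hvd.differentiableAt (ball_mem_nhds _ one_pos)).hasFDerivAt
  have hchain := hcomp.unique ((h.hasFDerivAt_zero s).congr_of_eventuallyEq
    (eventually_of_mem (ball_mem_nhds _ one_pos) hv))
  rw [ContinuousLinearMap.smul_comp, ContinuousLinearMap.id_comp] at hchain
  rw [Real.exp_sub, div_eq_inv_mul, mul_smul, ← hchain, inv_smul_smul₀ (Real.exp_ne_zero _)]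

theorem IsLoewnerChain.koebe_norm_le (h : IsLoewnerChain F) {s t : ℝ≥0} (hst : s < t)
    {x y : Cn n} (hx : x ∈ unitBall n) (hy : y ∈ unitBall n) (hxy : F t y = F s x) :
    koebe ‖y‖ ≤ ((1 + Real.exp (s - t)) / 2) ^ 2 * koebe ‖x‖ := by
  obtain ⟨v, hvd, hmaps, hv, hv0, hv'⟩ := h.exists_transition hst.le
  obtain rfl : y = v x := h.injOn t hy (hmaps hx) (hxy.trans (hv x hx).symm)
  have hx1 : ‖x‖ < 1 := mem_ball_zero_iff.1 hx
  set a := Real.exp (s - t)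
  have ha0 : 0 ≤ a := Real.exp_nonneg _
  have ha1 : a < 1 := Real.exp_lt_one_iff.2 (sub_neg.2 (NNReal.coe_lt_coe.2 hst))
  have hva : ‖fderiv ℂ v 0‖ ≤ a := by
    rw [hv', norm_smul, Real.norm_of_nonneg ha0]
    exact mul_le_of_le_one_right ha0 ContinuousLinearMap.norm_id_le
  have hvx := norm_le_of_norm_fderiv_zero_le hvd (hmaps.mono_right ball_subset_closedBall) hv0 ha1
    hva hx1
  refine (koebe_le_koebe (norm_nonneg _) hvx ?_).trans
    (koebe_mul_add_div_le ha0 (norm_nonneg _) hx1)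
  rw [← mul_div_assoc, div_lt_one (by positivity)]
  nlinarith [norm_nonneg x]

theorem IsLoewnerChain.koebe_norm_le_pow (h : IsLoewnerChain F) {τ : ℝ≥0} (hτ : 0 < τ) {x : Cn n}
    (hx : x ∈ unitBall n) (k : ℕ) {y : Cn n} (hy : y ∈ unitBall n) (hxy : F (k * τ) y = F 0 x) :
    koebe ‖y‖ ≤ (((1 + Real.exp (-τ)) / 2) ^ 2) ^ k * koebe ‖x‖ := by
  induction k generalizing y with
  | zero =>
    obtain rfl : y = x := h.injOn 0 hy hx (by simpa using hxy)
    simp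
  | succ k ih =>
    obtain ⟨w, hw, hwx⟩ := h.image_subset 0 (k * τ) zero_le (mem_image_of_mem _ hx)
    have hlt : k * τ < (k + 1 : ℕ) * τ := by gcongr; simp
    have hstep := h.koebe_norm_le hlt hw hy (hxy.trans hwx.symm)
    rw [show ((k * τ : ℝ≥0) : ℝ) - ((k + 1 : ℕ) * τ : ℝ≥0) = -τ by push_cast; ring] at hstep
    calc koebe ‖y‖ ≤ ((1 + Real.exp (-τ)) / 2) ^ 2 * koebe ‖w‖ := hstep
      _ ≤ ((1 + Real.exp (-τ)) / 2) ^ 2 * ((((1 + Real.exp (-τ)) / 2) ^ 2) ^ k * koebe ‖x‖) := by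
        gcongr
        exact ih hw hwx
      _ = (((1 + Real.exp (-τ)) / 2) ^ 2) ^ (k + 1) * koebe ‖x‖ := by ring

theorem IsLoewnerChain.koebe_norm_le_exp_neg_mul (h : IsLoewnerChain F) (t : ℝ≥0) {x y : Cn n}
    (hx : x ∈ unitBall n) (hy : y ∈ unitBall n) (hxy : F t y = F 0 x) :
    koebe ‖y‖ ≤ Real.exp (-t) * koebe ‖x‖ := by
  rcases eq_or_ne t 0 with rfl | ht
  · simp [h.injOn 0 hy hx hxy]
  have hbound (N : ℕ) : koebe ‖y‖ ≤
      Real.exp (-t + (t : ℝ) ^ 2 / 4 * (1 / (N + 1))) * koebe ‖x‖ := by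
    have hstep := h.koebe_norm_le_pow (τ := t / (N + 1)) (by positivity) hx (N + 1) hy
      (by rwa [Nat.cast_add_one, mul_div_cancel₀ _ (by positivity)])
    refine hstep.trans (mul_le_mul_of_nonneg_right ?_ (koebe_nonneg (norm_nonneg _)))
    simpa using sq_half_one_add_exp_neg_pow_le t N
  refine ge_of_tendsto' (x := atTop) ?_ hbound
  simpa using (((tendsto_one_div_add_atTop_nhds_zero_nat (𝕜 := ℝ)).const_mul
    ((t : ℝ) ^ 2 / 4)).const_add (-(t : ℝ))).rexp.mul_const (koebe ‖x‖)

theorem IsNormalFamily.exists_bound {𝓕 : Set (Cn n → Cn n)} {U K : Set (Cn n)}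
    (h : IsNormalFamily 𝓕 U) (hU : IsOpen U) (hc : ∀ g ∈ 𝓕, ContinuousOn g U) (hK : IsCompact K)
    (hKU : K ⊆ U) : ∃ M : ℝ, ∀ g ∈ 𝓕, ∀ z ∈ K, ‖g z‖ ≤ M := by
  by_contra! hunbounded
  choose u hu z hz hlt using fun k : ℕ ↦ hunbounded k
  obtain ⟨φ, g, hφ, hlim⟩ := h u hu
  have hg : ContinuousOn g U := hlim.continuousOn (Frequently.of_forall fun k ↦ hc _ (hu (φ k)))
  obtain ⟨C, hC⟩ := hK.exists_bound_of_continuousOn (hg.mono hKU)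
  have hunif := Metric.tendstoUniformlyOn_iff.1
    ((tendstoLocallyUniformlyOn_iff_forall_isCompact hU).1 hlim K hKU hK) 1 one_pos
  obtain ⟨N, hN⟩ := exists_nat_gt (C + 1)
  obtain ⟨k, hk, hNk⟩ := (hunif.and (eventually_ge_atTop N)).exists
  have hle : ‖u (φ k) (z (φ k))‖ ≤ C + 1 :=
    calc ‖u (φ k) (z (φ k))‖ ≤ ‖g (z (φ k))‖ + ‖g (z (φ k)) - u (φ k) (z (φ k))‖ :=
          norm_le_norm_add_norm_sub _ _
      _ ≤ C + 1 := add_le_add (hC _ (hz _)) (dist_eq_norm (g _) _ ▸ (hk _ (hz _)).le)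
  have hNφ : (N : ℝ) ≤ φ k := Nat.cast_le.2 (hNk.trans (hφ.id_le k))
  linarith [hlt (φ k)]

theorem IsNormalLoewnerChain.exists_norm_rescaled_sub_le (h : IsNormalLoewnerChain F) :
    ∃ C : ℝ, 0 ≤ C ∧ ∀ t, ∀ y ∈ ball (0 : Cn n) (1 / 2), ‖rescaled F t y - y‖ ≤ C * ‖y‖ ^ 2 := by
  have hhalf : closedBall (0 : Cn n) (1 / 2) ⊆ unitBall n := closedBall_subset_ball (by norm_num)
  obtain ⟨M, hM⟩ := h.normal.exists_bound isOpen_ball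
    (forall_mem_range.2 fun t ↦ (h.normalized t).holomorphic.continuousOn)
    (isCompact_closedBall 0 (1 / 2)) hhalf
  have hMt (t) : ∀ z ∈ ball (0 : Cn n) (1 / 2), ‖rescaled F t z‖ ≤ M := fun z hz ↦
    hM _ (mem_range_self t) z (ball_subset_closedBall hz)
  have hM0 : 0 ≤ M := (norm_nonneg _).trans (hMt 0 0 (mem_ball_self one_half_pos))
  refine ⟨16 * M, by positivity, fun t y hy ↦ ?_⟩
  have htaylor := norm_sub_linear_le_of_forall_mem_ball one_half_pos
    ((h.normalized t).holomorphic.mono (ball_subset_closedBall.trans hhalf)) (hMt t) hy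
  rw [(h.normalized t).map_zero, (h.normalized t).fderiv_zero, sub_zero, sub_zero,
    ContinuousLinearMap.id_apply] at htaylor
  exact htaylor.trans_eq (by ring)

theorem tendsto_exp_neg_coe_atTop :
    Tendsto (fun t : ℝ≥0 ↦ Real.exp (-t)) atTop (𝓝 0) :=
  Real.tendsto_exp_neg_atTop_nhds_zero.comp (NNReal.tendsto_coe_atTop.2 tendsto_id)

theorem IsNormalLoewnerChain.norm_le_koebe (h : IsNormalLoewnerChain F) {x : Cn n}
    (hx : x ∈ unitBall n) : ‖F 0 x‖ ≤ koebe ‖x‖ := by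
  obtain ⟨C, hC, hrescaled⟩ := h.exists_norm_rescaled_sub_le
  set κ := koebe ‖x‖
  have hsmall : ∀ᶠ t : ℝ≥0 in atTop, Real.exp (-t) * κ < 1 / 2 :=
    (tendsto_exp_neg_coe_atTop.mul_const κ).eventually_lt_const (by simp)
  have hlim : Tendsto (fun t : ℝ≥0 ↦ κ + C * κ ^ 2 * Real.exp (-t)) atTop (𝓝 κ) := by
    simpa using (tendsto_exp_neg_coe_atTop.const_mul (C * κ ^ 2)).const_add κ
  refine ge_of_tendsto hlim (hsmall.mono fun t ht ↦ ?_)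
  obtain ⟨y, hy, hyx⟩ := h.image_subset 0 t zero_le (mem_image_of_mem _ hx)
  have hyκ : ‖y‖ ≤ Real.exp (-t) * κ := (le_koebe (norm_nonneg _) (mem_ball_zero_iff.1 hy)).trans
    (h.koebe_norm_le_exp_neg_mul t hx hy hyx)
  have hexp : Real.exp t * Real.exp (-t) = 1 := by
    rw [← Real.exp_add, add_neg_cancel, Real.exp_zero]
  calc ‖F 0 x‖ = Real.exp t * ‖rescaled F t y‖ := by
        rw [← hyx, eq_exp_smul_rescaled F t, norm_smul, Real.norm_of_nonneg (Real.exp_nonneg _)]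
    _ ≤ Real.exp t * (‖y‖ + C * ‖y‖ ^ 2) := by
        gcongr
        exact (norm_le_norm_add_norm_sub' _ _).trans
          (by gcongr; exact hrescaled t y (mem_ball_zero_iff.2 (hyκ.trans_lt ht)))
    _ ≤ Real.exp t * (Real.exp (-t) * κ + C * (Real.exp (-t) * κ) ^ 2) := by gcongr
    _ = κ + C * κ ^ 2 * Real.exp (-t) := by
        linear_combination (κ + C * κ ^ 2 * Real.exp (-t)) * hexp

theorem norm_le_koebe_of_mem_classS0 {f : Cn n → Cn n} (hf : f ∈ classS0 n) {x : Cn n}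
    (hx : x ∈ unitBall n) : ‖f x‖ ≤ koebe ‖x‖ := by
  obtain ⟨-, F, hF, hFf⟩ := hf
  exact hFf hx ▸ hF.norm_le_koebe hx

end LoewnerChain

theorem koebe_mul_div_sq_sub_pow_four {R : ℝ} (hR0 : 0 < R) (hR1 : R < 1) :
    koebe R * R / (R ^ 2 - (R ^ 2) ^ 2) = (1 + R) ^ 2 / (1 - R ^ 2) ^ 3 := by
  have hsub : 1 - R ≠ 0 := (sub_pos.2 hR1).ne'
  rw [koebe, show R ^ 2 - (R ^ 2) ^ 2 = R ^ 2 * ((1 - R) * (1 + R)) by ring,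
    show 1 - R ^ 2 = (1 - R) * (1 + R) by ring]
  field_simp

theorem proposition1p4 (n : ℕ) (hn : 1 ≤ n) (f : Cn n → Cn n) (hf : f ∈ classS0 n)
    (r : ℝ) (hr : r ∈ Set.Ioo (0 : ℝ) 1) (z : Cn n) (hz : ‖z‖ ≤ r) :
    ‖fderiv ℂ f z‖ ≤ (1 + Real.sqrt r) ^ 2 / (1 - r) ^ 3 := by
  obtain ⟨hr0, hr1⟩ := hr
  set R := Real.sqrt r
  have hRr : R ^ 2 = r := Real.sq_sqrt hr0.le
  have hR0 : 0 < R := Real.sqrt_pos.2 hr0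
  have hR1 : R < 1 := (Real.sqrt_lt' one_pos).2 (by simpa using hr1)
  have hrR : r < R := by nlinarith
  have hsub : ball (0 : Cn n) R ⊆ unitBall n := ball_subset_ball hR1.le
  have hgrowth : ∀ y ∈ ball (0 : Cn n) R, ‖f y‖ ≤ koebe R := fun y hy ↦
    (norm_le_koebe_of_mem_classS0 hf (hsub hy)).trans
      (koebe_le_koebe (norm_nonneg y) (mem_ball_zero_iff.1 hy).le hR1)
  have hderiv : ‖fderiv ℂ f z‖ * (R ^ 2 - ‖z‖ ^ 2) ≤ koebe R * R :=
    norm_fderiv_mul_le_of_forall_mem_ball (hf.1.holomorphic.mono hsub) hgrowth (hz.trans_lt hrR)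
  have hpos : 0 < R ^ 2 - r ^ 2 := by nlinarith
  calc ‖fderiv ℂ f z‖ ≤ koebe R * R / (R ^ 2 - r ^ 2) := by
        rw [le_div_iff₀ hpos]
        exact le_trans (by gcongr) hderiv
    _ = (1 + R) ^ 2 / (1 - r) ^ 3 := by
        rw [← hRr, koebe_mul_div_sq_sub_pow_four hR0 hR1]
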